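/- **Theorem.** Let $G$ be a finite dimensional (Hausdorff, second countable) real Lie group with $\mathfrak g=T_eG$, and let $\rho:G\to U(\mathbf H)$ be a unitary representation on a complex Hilbert space $\mathbf H$ such that $g\mapsto\rho(g)x$ is continuous for every $x\in\mathbf H$. The Lie bracket of $\mathfrak g$ is normalized so that for left actions of $G$ the map from $\mathfrak g$ to fundamental vector fields is a homomorphism, i.e. it is the bracket of right invariant vector fields. Let $\mathbf H_\infty$ be the space of all $x\in\mathbf H$ for which $g\mapsto\rho(g)x$ is smooth, with the topology induced by the embedding $\mathbf H_\infty\to C^\infty(G,\mathbf H)$, $x\mapsto(g\mapsto\rho(g)x)$, where $C^\infty(G,\mathbf H)$ carries the topology of uniform convergence on compact sets of all derivatives separately. A curve in a real topological vector space is smooth if all its iterated derivatives exist, and a map is smooth if it sends smooth curves to smooth curves; $df(x)y=\lim_{t\to0}\frac{f(x+ty)-f(x)}t$. Let $\omega=\operatorname{Im}\langle\ ,\ \rangle$, where $\langle\ ,\ \rangle$ is linear in the first variable, and $\rho'(X)x=T_e(\rho(\ )x)X\in\mathbf H_\infty$ for $X\in\mathfrak g$, $x\in\mathbf H_\infty$.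 Let $C^\infty_*(\mathbf H_\infty,\mathbb R)$ be the space of all smooth $f:\mathbf H_\infty\to\mathbb R$ such that for each $k\ge1$ there is a smooth map $\xi_k:\mathbf H_\infty^k\to\mathbf H_\infty$ with $d^kf(x)(v,y_2,\dots,y_k)=\omega(\xi_k(x,y_2,\dots,y_k),v)$ for all $x,v,y_2,\dots,y_k\in\mathbf H_\infty$. For such $f$, $\operatorname{grad}f$ is given by $df(x)y=\omega(\operatorname{grad}f(x),y)$, and $\{f,g\}:=\omega(\operatorname{grad}g,\operatorname{grad}f)$. Let $C^\infty_*(\mathbf H_\infty,\mathfrak g')$ be the space of all smooth maps $\mathbf H_\infty\to\mathfrak g'=L(\mathfrak g,\mathbb R)$ all of whose components (evaluations at $X\in\mathfrak g$) lie in $C^\infty_*(\mathbf H_\infty,\mathbb R)$. On $C^\infty(\mathfrak g',\mathbb R)$ consider the Poisson bracket $\{f_1,f_2\}(\alpha)=\alpha([df_1(\alpha),df_2(\alpha)])$, where $df_i(\alpha)\in\mathfrak g''=\mathfrak g$. The moment mapping $\mu:\mathbf H_\infty\to\mathfrak g'$, $\mu(x)(X)=\tfrac12\,\omega(\rho'(X)x,x)$,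 has the following properties. 1. For all $x,y\in\mathbf H_\infty$ the derivative $d\mu(x)y$ exists, and $(d\mu(x)y)(X)=\omega(\rho'(X)x,y)$ for all $X\in\mathfrak g$; moreover $\mu\in C^\infty_*(\mathbf H_\infty,\mathfrak g')$. 2. For $x\in\mathbf H_\infty$ the set $\mathfrak g_x=\{X\in\mathfrak g:\rho'(X)x=0\}$ is the Lie algebra of the isotropy group $G_x=\{g\in G:\rho(g)x=x\}$, and the image of $d\mu(x):\mathbf H_\infty\to\mathfrak g'$ is the annihilator of $\mathfrak g_x$ in $\mathfrak g'$. 3. For $x\in\mathbf H_\infty$ the kernel of $d\mu(x)$ is $\{y\in\mathbf H_\infty:\omega(y,z)=0\text{ for all }z\in T_x(\rho(G)x)\}$, where $T_x(\rho(G)x)=\{\rho'(X)x:X\in\mathfrak g\}$ is the tangent space at $x$ of the $G$-orbit through $x$. 4. $\mu$ is equivariant: $\mathrm{Ad}'(g)\circ\mu=\mu\circ\rho(g)$ for all $g\in G$, where $\mathrm{Ad}'(g)\alpha=\alpha\circ\mathrm{Ad}(g^{-1})$ is the coadjoint action. 5. If $f\in C^\infty(\mathfrak g',\mathbb R)$ then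 $\mu^*f=f\circ\mu\in C^\infty_*(\mathbf H_\infty,\mathbb R)$, and $\mu^*:C^\infty(\mathfrak g',\mathbb R)\to C^\infty_*(\mathbf H_\infty,\mathbb R)$ is a Lie algebra homomorphism: it is linear, $C^\infty(\mathfrak g',\mathbb R)$ is closed under its Poisson bracket, and $\mu^*\{f_1,f_2\}=\{\mu^*f_1,\mu^*f_2\}$. -/

import Mathlib

open scoped Manifold ContDiff Topology

noncomputable section

namespace UnitaryMoment

/-! ### Smooth curves and smooth maps in the sense of Frölicher and Kriegl -/

/-- A curve `c : ℝ → V` in a real topological vector space is smooth if all its iterated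
derivatives exist (they are then automatically continuous): there is a sequence of curves `d 0 = c`,
`d 1`, `d 2`, … such that each `d (n + 1)` is the derivative of `d n`. -/
def SmoothCurve {V : Type*} [AddCommGroup V] [Module ℝ V] [TopologicalSpace V] (c : ℝ → V) : Prop :=
  ∃ d : ℕ → ℝ → V, d 0 = c ∧
    ∀ n t, Filter.Tendsto (fun s : ℝ => (s - t)⁻¹ • (d n s - d n t)) (𝓝[≠] t) (𝓝 (d (n + 1) t))

/-- A map is smooth if it maps smooth curves to smooth curves. -/
def FKSmooth {V W : Type*} [AddCommGroup V] [Module ℝ V] [TopologicalSpace V]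
    [AddCommGroup W] [Module ℝ W] [TopologicalSpace W] (f : V → W) : Prop :=
  ∀ c : ℝ → V, SmoothCurve c → SmoothCurve (f ∘ c)

/-- The iterated derivative `dᵏf(x)(y 0, …, y (k-1))` of a real function on a real vector space,
obtained by iterating `df(x)v = lim_{t → 0} (f (x + t v) - f x) / t`. -/
def iterDeriv {V : Type*} [AddCommGroup V] [Module ℝ V] (f : V → ℝ) :
    (k : ℕ) → (Fin k → V) → V → ℝ
  | 0, _ => f
  | k + 1, y => fun x => lineDeriv ℝ (iterDeriv f k (Fin.tail y)) x (y 0)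

section LieGroup

variable (E : Type*) [NormedAddCommGroup E] [NormedSpace ℝ E]
  (G : Type*) [TopologicalSpace G] [ChartedSpace E G] [Group G]

/-- The Lie algebra `𝔤 = T_e G`. In Mathlib the tangent space at a point of a manifold modelled on
`E` is by definition the vector space `E`; it is written as `E` here so that it has a norm. -/
abbrev LieAlg (E : Type*) [NormedAddCommGroup E] [NormedSpace ℝ E]
    (G : Type*) [TopologicalSpace G] [ChartedSpace E G] [Group G] : Type _ := E

/-- The dual `𝔤' = L(𝔤, ℝ)`. -/
abbrev LieDual : Type _ := LieAlg E G →L[ℝ] ℝ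

variable {E G}

/-- The adjoint representation: `Ad g` is the derivative at `e` of `h ↦ g h g⁻¹`. -/
def Ad (g : G) : LieAlg E G →L[ℝ] LieAlg E G :=
  mfderiv 𝓘(ℝ, E) 𝓘(ℝ, E) (fun h : G => g * h * g⁻¹) 1

/-- The coadjoint action `Ad'(g) = Ad(g⁻¹)' : 𝔤' → 𝔤'`. -/
def coAd (g : G) (α : LieDual E G) : LieDual E G := α.comp (Ad g⁻¹)

/-- The right invariant vector field with value `X` at `e`. -/
def rightInvariantField (X : LieAlg E G) (g : G) : TangentSpace 𝓘(ℝ, E) g :=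
  mfderiv 𝓘(ℝ, E) 𝓘(ℝ, E) (fun h : G => h * g) 1 X

/-- The Lie bracket of `𝔤`, normalized so that for every left action of `G` the map from `𝔤` to
fundamental vector fields is a homomorphism of Lie algebras (not an antihomomorphism): it is the
bracket of right invariant vector fields. It is the negative of the bracket of left invariant ones. -/
def lieBracket (X Y : LieAlg E G) : LieAlg E G :=
  VectorField.mlieBracket 𝓘(ℝ, E) (rightInvariantField (G := G) X) (rightInvariantField (G := G) Y)
    (1 : G)

/-- The Lie algebra of a closed subgroup `S` of `G`: all `X ∈ 𝔤` whose one-parameter subgroup stays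
in `S`. (A one-parameter subgroup that is differentiable at `0` is automatically smooth, and is
determined by its derivative at `0`.) -/
def subgroupLieAlg (E : Type*) [NormedAddCommGroup E] [NormedSpace ℝ E]
    {G : Type*} [TopologicalSpace G] [ChartedSpace E G] [Group G] (S : Subgroup G) :
    Set (LieAlg E G) :=
  {X | ∃ γ : ℝ → G, (∀ s t, γ (s + t) = γ s * γ t) ∧
    HasMFDerivAt 𝓘(ℝ, ℝ) 𝓘(ℝ, E) γ 0 (ContinuousLinearMap.toSpanSingleton ℝ X) ∧
    ∀ t, γ t ∈ S}

/-- Every linear functional on `𝔤'` is evaluation at an element of `𝔤`. -/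
theorem exists_eval_eq [FiniteDimensional ℝ E] (L : LieDual E G →L[ℝ] ℝ) :
    ∃ X : LieAlg E G, ∀ β : LieDual E G, L β = β X := by
  let e : (E →ₗ[ℝ] ℝ) ≃ₗ[ℝ] (E →L[ℝ] ℝ) := LinearMap.toContinuousLinearMap
  refine ⟨(Module.evalEquiv ℝ E).symm (L.toLinearMap ∘ₗ e.toLinearMap), fun β => ?_⟩
  have h := Module.apply_evalEquiv_symm_apply (R := ℝ) (M := E) (e.symm β)
    (L.toLinearMap ∘ₗ e.toLinearMap)
  have h2 : (e.symm β) ((Module.evalEquiv ℝ E).symm (L.toLinearMap ∘ₗ e.toLinearMap)) =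
    β ((Module.evalEquiv ℝ E).symm (L.toLinearMap ∘ₗ e.toLinearMap)) := rfl
  rw [← h2, h]
  simp

/-- The differential `df(α) ∈ 𝔤'' = 𝔤` of a function on `𝔤'`, as the element of `𝔤` (it is unique)
with `df(α)(β) = β(df(α))` for all `β ∈ 𝔤'`. -/
def dualDiff [FiniteDimensional ℝ E] (f : LieDual E G → ℝ) (α : LieDual E G) : LieAlg E G :=
  (exists_eval_eq (G := G) (fderiv ℝ f α)).choose

/-- The Poisson bracket on `𝔤'`: `{f₁, f₂}(α) = α([df₁(α), df₂(α)])`. -/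
def dualPoisson [FiniteDimensional ℝ E] (f₁ f₂ : LieDual E G → ℝ) (α : LieDual E G) : ℝ :=
  α (lieBracket (G := G) (dualDiff f₁ α) (dualDiff f₂ α))

end LieGroup

section Topology

variable (E : Type*) [NormedAddCommGroup E] [NormedSpace ℝ E]
  (G : Type*) [TopologicalSpace G] [ChartedSpace E G]
  (H : Type*) [NormedAddCommGroup H] [NormedSpace ℝ H]

/-- The compact `C^∞`-topology on `C^∞(G, H)`: uniform convergence on compact subsets of the chart
domains of each derivative in the charts, separately. -/
@[reducible] def compactCInfty : TopologicalSpace C^∞⟮𝓘(ℝ, E), G; 𝓘(ℝ, H), H⟯ :=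
  ⨅ (p : G) (k : ℕ), TopologicalSpace.induced
    (fun f => UniformOnFun.ofFun {K : Set E | IsCompact K ∧ K ⊆ (chartAt E p).target}
      (iteratedFDeriv ℝ k (f ∘ (chartAt E p).symm)))
    inferInstance

end Topology

section Representation

variable {E : Type*} [NormedAddCommGroup E] [NormedSpace ℝ E]
  {G : Type*} [TopologicalSpace G] [ChartedSpace E G] [Group G] [LieGroup 𝓘(ℝ, E) ∞ G]
  {H : Type*} [NormedAddCommGroup H] [InnerProductSpace ℂ H]

/-- The subspace of smooth vectors of a unitary representation. -/
def smoothSubmodule (E : Type*) [NormedAddCommGroup E] [NormedSpace ℝ E]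
    {G : Type*} [TopologicalSpace G] [ChartedSpace E G] [Group G]
    {H : Type*} [NormedAddCommGroup H] [InnerProductSpace ℂ H]
    (ρ : G →* (H ≃ₗᵢ[ℂ] H)) : Submodule ℂ H where
  carrier := {x | ContMDiff 𝓘(ℝ, E) 𝓘(ℝ, H) ∞ (fun g : G => ρ g x)}
  zero_mem' := by simpa using contMDiff_const
  add_mem' := by
    intro x y hx hy
    have h := ContMDiff.add hx hy
    have h2 : ((fun g : G => ρ g x) + fun g : G => ρ g y) = fun g : G => ρ g (x + y) := by
      funext a
      simp
    rwa [h2] at h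
  smul_mem' := by
    intro c x hx
    have h : ContMDiff 𝓘(ℝ, H) 𝓘(ℝ, H) ∞ (fun z : H => c • z) :=
      ((c • (ContinuousLinearMap.id ℝ H) : H →L[ℝ] H)).contMDiff
    have h2 := h.comp hx
    have h3 : ((fun z : H => c • z) ∘ fun g : G => ρ g x) = fun g : G => ρ g (c • x) := by
      funext a
      simp
    rwa [h3] at h2

/-- The space `H_∞` of smooth vectors. This is a type synonym: its topology is not the one induced
by the norm of `H`. -/
def SmoothVec (E : Type*) [NormedAddCommGroup E] [NormedSpace ℝ E]
    {G : Type*} [TopologicalSpace G] [ChartedSpace E G] [Group G]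
    {H : Type*} [NormedAddCommGroup H] [InnerProductSpace ℂ H]
    (ρ : G →* (H ≃ₗᵢ[ℂ] H)) : Type _ := smoothSubmodule E ρ

variable (ρ : G →* (H ≃ₗᵢ[ℂ] H))

instance : AddCommGroup (SmoothVec E ρ) := inferInstanceAs (AddCommGroup (smoothSubmodule E ρ))

/-- `H_∞` is a complex vector space, and a real one by restriction of scalars. -/
instance : Module ℂ (SmoothVec E ρ) := inferInstanceAs (Module ℂ (smoothSubmodule E ρ))

/-- The underlying vector in `H` of a smooth vector. -/
def SmoothVec.val {ρ : G →* (H ≃ₗᵢ[ℂ] H)} (x : SmoothVec E ρ) : H := Subtype.val x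

/-- The embedding `j : H_∞ → C^∞(G, H)`, `x ↦ (g ↦ ρ(g)x)`. -/
def SmoothVec.toMap {ρ : G →* (H ≃ₗᵢ[ℂ] H)} (x : SmoothVec E ρ) :
    C^∞⟮𝓘(ℝ, E), G; 𝓘(ℝ, H), H⟯ := ⟨fun g => ρ g x.val, x.2⟩

/-- `H_∞` carries the topology induced from the compact `C^∞`-topology on `C^∞(G, H)`. -/
instance : TopologicalSpace (SmoothVec E ρ) :=
  TopologicalSpace.induced SmoothVec.toMap (compactCInfty E G H)

/-- The action of `G` on smooth vectors. -/
def SmoothVec.act (g : G) (x : SmoothVec E ρ) : SmoothVec E ρ :=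
  ⟨ρ g x.val, by
    have h : ContMDiff 𝓘(ℝ, E) 𝓘(ℝ, H) ∞ (fun h : G => ρ h x.val) := x.2
    have h2 : ContMDiff 𝓘(ℝ, E) 𝓘(ℝ, E) ∞ (fun h : G => h * g) := contMDiff_mul_right
    have h3 := h.comp h2
    have h4 : ((fun h : G => ρ h x.val) ∘ fun h : G => h * g) = fun h : G => ρ h (ρ g x.val) := by
      funext a
      simp
    rw [h4] at h3
    exact h3⟩

/-- `ω = Im ⟨ , ⟩`, where the Hermitian inner product `⟨x, y⟩` is linear in `x`. Mathlib's inner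
product is linear in the second argument, whence the order of the arguments. -/
def omega (x y : SmoothVec E ρ) : ℝ := (inner ℂ y.val x.val : ℂ).im

theorem deriv_mem (x : SmoothVec E ρ) (X : LieAlg E G) :
    (mfderiv 𝓘(ℝ, E) 𝓘(ℝ, H) (fun g : G => ρ g x.val) 1 X : H) ∈ smoothSubmodule E ρ := by
  have hx : ContMDiff 𝓘(ℝ, E) 𝓘(ℝ, H) ∞ (fun g : G => ρ g x.val) := x.2
  have hF : ContMDiff (𝓘(ℝ, E).prod 𝓘(ℝ, E)) 𝓘(ℝ, H) ∞
      (Function.uncurry fun g h : G => ρ (g * h) x.val) := hx.comp (contMDiff_mul 𝓘(ℝ, E) ∞)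
  have : IsManifold 𝓘(ℝ, E) 1 G := IsManifold.of_le (n := ∞) (by simp)
  show ContMDiff 𝓘(ℝ, E) 𝓘(ℝ, H) ∞ _
  intro g
  have h1 := ContMDiffAt.mfderiv (m := ∞) (fun g h : G => ρ (g * h) x.val) (fun _ : G => (1 : G))
    (x₀ := g) hF.contMDiffAt contMDiffAt_const (by simp)
  have h2 := h1.clm_apply (contMDiffAt_const (c := (X : E)))
  refine h2.congr_of_eventuallyEq (Filter.Eventually.of_forall fun g => ?_)
  have h3 : (fun h : G => ρ (g * h) x.val) =
      (((ρ g).toContinuousLinearEquiv.toContinuousLinearMap.restrictScalars ℝ : H →L[ℝ] H) ∘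
        fun h : G => ρ h x.val) := by
    funext a
    simp
  have h4 := mfderiv_comp (I := 𝓘(ℝ, E)) (I' := 𝓘(ℝ, H)) (I'' := 𝓘(ℝ, H)) (1 : G)
    ((ρ g).toContinuousLinearEquiv.toContinuousLinearMap.restrictScalars ℝ : H →L[ℝ] H).mdifferentiableAt
    (hx.mdifferentiableAt (x := 1) (by simp))
  rw [← h3] at h4
  have h5 : (trivializationAt E (TangentSpace 𝓘(ℝ, E)) (1 : G)).symmL ℝ 1 X = X := by
    rw [TangentBundle.symmL_trivializationAt_eq_core (mem_chart_source E 1)]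
    exact (tangentBundleCore 𝓘(ℝ, E) G).coordChange_self (achart E 1) 1 (mem_achart_source E 1) X
  have h6 : mfderiv 𝓘(ℝ, E) 𝓘(ℝ, H) (fun h : G => ρ (g * h) x.val) 1 X =
      ρ g (mfderiv 𝓘(ℝ, E) 𝓘(ℝ, H) (fun h : G => ρ h x.val) 1 X : H) := by
    rw [h4, mfderiv_eq_fderiv, ContinuousLinearMap.fderiv]
    rfl
  simp only [inTangentCoordinates, ContinuousLinearMap.inCoordinates,
    TangentBundle.continuousLinearMapAt_model_space]
  exact h6.symm.trans (congrArg (mfderiv 𝓘(ℝ, E) 𝓘(ℝ, H) (fun h : G => ρ (g * h) x.val) 1) h5.symm)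

/-- The infinitesimal representation `ρ'(X)x = T_e(ρ( )x) X`. -/
def infRep (X : LieAlg E G) (x : SmoothVec E ρ) : SmoothVec E ρ :=
  ⟨mfderiv 𝓘(ℝ, E) 𝓘(ℝ, H) (fun g : G => ρ g x.val) 1 X, deriv_mem ρ x X⟩

/-- The moment map `μ : H_∞ → 𝔤'`, `μ(x)(X) = ½ ω(ρ'(X)x, x)`. -/
def moment (x : SmoothVec E ρ) : LieDual E G where
  toFun X := 1 / 2 * omega ρ (infRep ρ X x) x
  map_add' X Y := by
    let D : E →L[ℝ] H := mfderiv 𝓘(ℝ, E) 𝓘(ℝ, H) (fun g : G => ρ g x.val) 1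
    change 1 / 2 * (inner ℂ x.val (D (X + Y)) : ℂ).im =
      1 / 2 * (inner ℂ x.val (D X) : ℂ).im + 1 / 2 * (inner ℂ x.val (D Y) : ℂ).im
    rw [map_add, inner_add_right, Complex.add_im, mul_add]
  map_smul' c X := by
    let D : E →L[ℝ] H := mfderiv 𝓘(ℝ, E) 𝓘(ℝ, H) (fun g : G => ρ g x.val) 1
    change 1 / 2 * (inner ℂ x.val (D (c • X)) : ℂ).im =
      c * (1 / 2 * (inner ℂ x.val (D X) : ℂ).im)
    rw [map_smul, inner_smul_right_eq_smul, Complex.smul_im, smul_eq_mul]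
    ring
  cont := by
    let D : E →L[ℝ] H := mfderiv 𝓘(ℝ, E) 𝓘(ℝ, H) (fun g : G => ρ g x.val) 1
    change Continuous fun X : E => 1 / 2 * (inner ℂ x.val (D X) : ℂ).im
    exact continuous_const.mul (Complex.continuous_im.comp (continuous_const.inner D.continuous))

/-- `C^∞_*(H_∞, ℝ)`: the smooth functions `f` on `H_∞` such that for each `k` and all `x`, `y₂, …`,
the functional `dᵏf(x)( , y₂, …, y_k)` lies in the smooth dual `ω(H_∞, )`, and is represented by an
element of `H_∞` (it is unique, as `ω` is nondegenerate) that depends smoothly on `(x, y₂, …, y_k)`.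
The index `k` below is one less than here. -/
def MemCStar (f : SmoothVec E ρ → ℝ) : Prop :=
  FKSmooth f ∧ ∀ k : ℕ, ∃ ξ : SmoothVec E ρ × (Fin k → SmoothVec E ρ) → SmoothVec E ρ,
    FKSmooth ξ ∧ ∀ x y v, iterDeriv f (k + 1) (Fin.cons v y) x = omega ρ (ξ (x, y)) v

/-- `C^∞_*(H_∞, 𝔤')`: the smooth maps into the finite dimensional space `𝔤'` with all components in
`C^∞_*(H_∞, ℝ)`. -/
def MemCStarDual (F : SmoothVec E ρ → LieDual E G) : Prop :=
  FKSmooth F ∧ ∀ X : LieAlg E G, MemCStar ρ (fun x => F x X)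

/-- The `ω`-gradient: the element of `H_∞` with `df(x)y = ω(grad f(x), y)` for all `y`
(unique if it exists, which is the case for `f` in `C^∞_*(H_∞, ℝ)`). -/
def omegaGrad (f : SmoothVec E ρ → ℝ) (x : SmoothVec E ρ) : SmoothVec E ρ :=
  Classical.epsilon fun z => ∀ y, lineDeriv ℝ f x y = omega ρ z y

/-- The Poisson bracket `{f, g} = ω(grad g, grad f)` on `C^∞_*(H_∞, ℝ)`. -/
def poisson (f g : SmoothVec E ρ → ℝ) (x : SmoothVec E ρ) : ℝ :=
  omega ρ (omegaGrad ρ g x) (omegaGrad ρ f x)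

/-- The isotropy group `G_x = {g | ρ(g)x = x}`. -/
def isotropyGroup (x : SmoothVec E ρ) : Subgroup G where
  carrier := {g | SmoothVec.act ρ g x = x}
  one_mem' := by
    apply Subtype.ext
    change ρ 1 x.val = x.val
    simp
  mul_mem' := by
    intro a b ha hb
    have ha' : ρ a x.val = x.val := congrArg SmoothVec.val ha
    have hb' : ρ b x.val = x.val := congrArg SmoothVec.val hb
    apply Subtype.ext
    change ρ (a * b) x.val = x.val
    rw [map_mul, LinearIsometryEquiv.coe_mul, Function.comp_apply, hb', ha']
  inv_mem' := by
    intro a ha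
    have ha' : ρ a x.val = x.val := congrArg SmoothVec.val ha
    apply Subtype.ext
    change ρ a⁻¹ x.val = x.val
    conv_lhs => rw [← ha']
    rw [← Function.comp_apply (f := ρ a⁻¹) (g := ρ a), ← LinearIsometryEquiv.coe_mul, ← map_mul,
      inv_mul_cancel, map_one]
    rfl

/-- The isotropy Lie algebra `𝔤_x = {X | ρ'(X)x = 0}`. -/
def isotropyAlg (x : SmoothVec E ρ) : Set (LieAlg E G) := {X | infRep ρ X x = 0}

/-- The tangent space at `x` of the orbit `ρ(G)x`: the image of `T_e G` under the derivative at `e`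
of the orbit map `g ↦ ρ(g)x`. -/
def orbitTangent (x : SmoothVec E ρ) : Set (SmoothVec E ρ) :=
  Set.range fun X : LieAlg E G => infRep ρ X x

end Representation

end UnitaryMoment

end

open UnitaryMoment

/-!
The proof rests on one fact about the space `H_∞` of smooth vectors: the operators `ρ'(X)` are
continuous for its topology. By left invariance, the orbit map of `ρ'(X)x` is the derivative of the
orbit map of `x` along the left invariant vector field of `X`, so that in a chart `ρ'(X)` is a
differential operator of first order with smooth coefficients, and its derivatives of order `k` are
bounded on compact sets by those of order at most `k + 1` of the argument (`infRepL`). Together with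
the Leibniz rule for smooth curves in a topological vector space (`SmoothCurve.smul`) it follows
that `ρ'(X)x` is smooth in `X` and `x` jointly (`SmoothCurve.infRep`). The inclusion of `H_∞` into
`H` is continuous too, so `ω` is smooth along smooth curves.

Differentiating `⟨ρ(g)x, ρ(g)y⟩ = ⟨x, y⟩` shows that `ρ'(X)` is skew for `ω`. Hence
`B(x, y)(X) = ω(ρ'(X)x, y)` is symmetric, and `μ(x) = ½ B(x, x)` has the derivative `B(x, ·)` at
`x`. Its kernel can be read off, and its image is found by duality in the finite dimensional space `𝔤`,
as `ω` is nondegenerate (`range_polar`). That `𝔤_x` is the Lie algebra of `G_x` needs one-parameter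
subgroups; these are integral curves of left invariant vector fields, which are complete since
left translation turns the existence time at `e` into a uniform one.

For smooth `f` on `𝔤'`, induction shows that `dᵏ(f ∘ μ)(x)(y₁, …, y_k)` is a smooth function of the
elements `μ(x)`, `B(x, y_a)`, `B(y_a, y_b)` of `𝔤'` (`exists_iterDeriv_eq`). The derivative of such
a function in a direction `v` is a linear combination of values of `B(x, v)` and `B(y_a, v)`, hence of
the form `ω(ξ, v)`, where `ξ` is `ρ'(X₀)x + ∑ ρ'(X_a)y_a` with coefficients in `𝔤` that depend
smoothly on the invariants (`invariantGrad`). In particular `grad (f ∘ μ)(x) = ρ'(df(μ(x)))x`.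

For the Poisson brackets, inversion of `G` exchanges left and right invariant vector fields, so the
bracket of `𝔤` used here is the opposite of that of left invariant fields (`lieBracket_eq_neg`).
Differentiating orbit maps along left invariant fields then gives
`ρ'([X, Y]) = ρ'(Y)ρ'(X) - ρ'(X)ρ'(Y)` (`infRep_lieBracket`), and skewness turns `μ(x)([X, Y])` into
`ω(ρ'(Y)x, ρ'(X)x)`.
-/

noncomputable section

namespace UnitaryMoment

/-! ### Calculus of smooth curves -/

section SmoothCurve

variable {V W : Type*} [AddCommGroup V] [Module ℝ V] [TopologicalSpace V]
  [AddCommGroup W] [Module ℝ W] [TopologicalSpace W]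

/-- The curve `d` is the derivative of the curve `c`. -/
def CurveDeriv (c d : ℝ → V) : Prop :=
  ∀ t, Filter.Tendsto (fun s : ℝ => (s - t)⁻¹ • (c s - c t)) (𝓝[≠] t) (𝓝 (d t))

/-- Coinduction principle: a family of curves, each of which has a derivative belonging to the
family again, consists of smooth curves. -/
theorem SmoothCurve.of_mem {S : Set (ℝ → V)} (hS : ∀ c ∈ S, ∃ d ∈ S, CurveDeriv c d)
    {c : ℝ → V} (hc : c ∈ S) : SmoothCurve c := by
  choose! D hD hD' using hS
  have hmem : ∀ n, D^[n] c ∈ S := fun n => by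
    induction n with
    | zero => exact hc
    | succ n ih => rw [Function.iterate_succ_apply']; exact hD _ ih
  refine ⟨fun n => D^[n] c, rfl, fun n => ?_⟩
  have h := hD' _ (hmem n)
  rw [← Function.iterate_succ_apply' D] at h
  exact h

theorem SmoothCurve.exists_deriv {c : ℝ → V} (hc : SmoothCurve c) :
    ∃ d, SmoothCurve d ∧ CurveDeriv c d := by
  obtain ⟨d, rfl, hd⟩ := hc
  exact ⟨d 1, ⟨fun n => d (n + 1), rfl, fun n => hd (n + 1)⟩, hd 0⟩

theorem CurveDeriv.clm_comp (L : V →L[ℝ] W) {c d : ℝ → V} (h : CurveDeriv c d) :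
    CurveDeriv (L ∘ c) (L ∘ d) := fun t => by
  simpa [Function.comp_def] using (L.continuous.tendsto (d t)).comp (h t)

theorem SmoothCurve.clm_comp (L : V →L[ℝ] W) {c : ℝ → V} (hc : SmoothCurve c) :
    SmoothCurve (L ∘ c) := by
  obtain ⟨d, rfl, hd⟩ := hc
  exact ⟨fun n => L ∘ d n, rfl, fun n => CurveDeriv.clm_comp L (hd n)⟩

theorem curveDeriv_iff_hasDerivAt {F : Type*} [NormedAddCommGroup F] [NormedSpace ℝ F]
    {c d : ℝ → F} : CurveDeriv c d ↔ ∀ t, HasDerivAt c (d t) t := by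
  simp only [CurveDeriv, hasDerivAt_iff_tendsto_slope]
  rfl

/-- In a normed space, a curve is smooth iff it is `C^∞`. -/
theorem smoothCurve_iff_contDiff {F : Type*} [NormedAddCommGroup F] [NormedSpace ℝ F]
    {c : ℝ → F} : SmoothCurve c ↔ ContDiff ℝ ∞ c := by
  constructor
  · rintro ⟨d, rfl, hd⟩
    have h : ∀ n t, HasDerivAt (d n) (d (n + 1) t) t := fun n =>
      curveDeriv_iff_hasDerivAt.1 (hd n)
    have h' : ∀ n, iteratedDeriv n (d 0) = d n := fun n => by
      induction n with
      | zero => simp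
      | succ n ih =>
        rw [iteratedDeriv_succ, ih]
        exact funext fun t => (h n t).deriv
    refine contDiff_of_differentiable_iteratedDeriv fun m _ => ?_
    rw [h' m]
    exact fun t => (h m t).differentiableAt
  · intro hc
    refine SmoothCurve.of_mem (S := {c | ContDiff ℝ ∞ c}) (fun c hc => ?_) hc
    have hc' : ContDiff ℝ ∞ c := hc
    exact ⟨deriv c, (contDiff_infty_iff_deriv.1 hc').2, curveDeriv_iff_hasDerivAt.2 fun t =>
      ((contDiff_infty_iff_deriv.1 hc').1 t).hasDerivAt⟩

theorem smoothCurve_zero : SmoothCurve (0 : ℝ → V) :=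
  ⟨fun _ => 0, rfl, fun _ t => by simpa using tendsto_const_nhds⟩

variable [ContinuousAdd V]

theorem CurveDeriv.add {c d c' d' : ℝ → V} (h : CurveDeriv c d) (h' : CurveDeriv c' d') :
    CurveDeriv (c + c') (d + d') := fun t => by
  refine ((h t).add (h' t)).congr fun s => ?_
  rw [← smul_add]
  congr 1
  simp only [Pi.add_apply]
  abel

theorem SmoothCurve.add {c c' : ℝ → V} (h : SmoothCurve c) (h' : SmoothCurve c') :
    SmoothCurve (c + c') := by
  obtain ⟨d, rfl, hd⟩ := h
  obtain ⟨d', rfl, hd'⟩ := h'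
  exact ⟨fun n => d n + d' n, rfl, fun n => CurveDeriv.add (hd n) (hd' n)⟩

theorem SmoothCurve.sum {ι : Type*} (s : Finset ι) {c : ι → ℝ → V}
    (h : ∀ i ∈ s, SmoothCurve (c i)) : SmoothCurve (∑ i ∈ s, c i) :=
  Finset.sum_induction _ _ (fun _ _ => SmoothCurve.add) smoothCurve_zero h

variable [ContinuousSMul ℝ V]

theorem CurveDeriv.continuous {c d : ℝ → V} (h : CurveDeriv c d) : Continuous c := by
  refine continuous_iff_continuousAt.2 fun t => continuousWithinAt_compl_self.1 ?_
  have h1 : Filter.Tendsto (fun s : ℝ => s - t) (𝓝[≠] t) (𝓝 0) := by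
    have : Filter.Tendsto (fun s : ℝ => s - t) (𝓝 t) (𝓝 (t - t)) :=
      (continuous_id.sub continuous_const).tendsto t
    rw [sub_self] at this
    exact this.mono_left nhdsWithin_le_nhds
  have h2 := (h1.smul (h t)).add_const (c t)
  rw [zero_smul, zero_add] at h2
  refine h2.congr' ?_
  filter_upwards [self_mem_nhdsWithin] with s hs
  rw [smul_smul, mul_inv_cancel₀ (sub_ne_zero.2 hs), one_smul, sub_add_cancel]

theorem CurveDeriv.smul {r r' : ℝ → ℝ} {c d : ℝ → V} (hr : CurveDeriv r r')
    (hc : CurveDeriv c d) : CurveDeriv (fun t => r t • c t) (fun t => r' t • c t + r t • d t) :=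
  fun t => by
  have h1 : Filter.Tendsto c (𝓝[≠] t) (𝓝 (c t)) :=
    (hc.continuous.tendsto t).mono_left nhdsWithin_le_nhds
  refine (((hr t).smul h1).add ((hc t).const_smul (r t))).congr fun s => ?_
  simp only [smul_eq_mul]
  module

/-- The product of a smooth curve with a smooth real function is smooth. -/
theorem SmoothCurve.smul {r : ℝ → ℝ} {c : ℝ → V} (hr : ContDiff ℝ ∞ r) (hc : SmoothCurve c) :
    SmoothCurve (fun t => r t • c t) := by
  -- finite sums of such products are closed under differentiation
  let P : Set (ℝ → V) := {b | ∃ r : ℝ → ℝ, ∃ c, SmoothCurve r ∧ SmoothCurve c ∧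
    b = fun t => r t • c t}
  refine SmoothCurve.of_mem (S := AddSubmonoid.closure P) (fun b hb => ?_)
    (AddSubmonoid.subset_closure (show _ ∈ P from ⟨r, c, smoothCurve_iff_contDiff.2 hr, hc, rfl⟩))
  induction hb using AddSubmonoid.closure_induction with
  | mem b hb =>
    obtain ⟨r, c, hr, hc, rfl⟩ := hb
    obtain ⟨r', hr', hrr⟩ := hr.exists_deriv
    obtain ⟨d, hd, hcd⟩ := hc.exists_deriv
    exact ⟨_, add_mem (AddSubmonoid.subset_closure ⟨r', c, hr', hc, rfl⟩)
      (AddSubmonoid.subset_closure ⟨r, d, hr, hd, rfl⟩), hrr.smul hcd⟩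
  | zero => exact ⟨0, zero_mem _, fun t => by simpa using tendsto_const_nhds⟩
  | add b b' _ _ h h' =>
    obtain ⟨d, hd, hbd⟩ := h
    obtain ⟨d', hd', hbd'⟩ := h'
    exact ⟨d + d', add_mem hd hd', hbd.add hbd'⟩

end SmoothCurve

/-! ### The topology on the space of smooth vectors -/

section Topology

variable {E : Type*} [NormedAddCommGroup E] [NormedSpace ℝ E]
  {G : Type*} [TopologicalSpace G] [ChartedSpace E G] [Group G]
  {H : Type*} [NormedAddCommGroup H] [InnerProductSpace ℂ H]
  {ρ : G →* (H ≃ₗᵢ[ℂ] H)}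

/-- The orbit map `g ↦ ρ(g)x` in the preferred chart at `p`. -/
def chartOrbit (p : G) (x : SmoothVec E ρ) (u : E) : H := ρ ((chartAt E p).symm u) x.val

/-- Convergence in `H_∞` is uniform convergence, on compact subsets of charts, of all derivatives
of the orbit maps. -/
theorem tendsto_smoothVec_iff {ι : Type*} {l : Filter ι} {a : ι → SmoothVec E ρ}
    {x : SmoothVec E ρ} : Filter.Tendsto a l (𝓝 x) ↔
      ∀ (p : G) (k : ℕ) (K : Set E), IsCompact K → K ⊆ (chartAt E p).target →
        TendstoUniformlyOn (fun i => iteratedFDeriv ℝ k (chartOrbit p (a i)))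
          (iteratedFDeriv ℝ k (chartOrbit p x)) l K := by
  rw [@nhds_induced _ _ (compactCInfty E G H), Filter.tendsto_comap_iff]
  simp only [nhds_iInf, Filter.tendsto_iInf, nhds_induced, Filter.tendsto_comap_iff,
    UniformOnFun.tendsto_iff_tendstoUniformlyOn, Set.mem_ofPred_eq, and_imp]
  rfl

theorem contMDiff_orbit (x : SmoothVec E ρ) :
    ContMDiff 𝓘(ℝ, E) 𝓘(ℝ, H) ∞ (fun g : G => ρ g x.val) := x.2

theorem contDiffOn_chartOrbit [IsManifold 𝓘(ℝ, E) ∞ G] (p : G) (x : SmoothVec E ρ) :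
    ContDiffOn ℝ ∞ (chartOrbit p x) (chartAt E p).target := by
  rw [← contMDiffOn_iff_contDiffOn]
  exact (contMDiff_orbit x).comp_contMDiffOn (contMDiffOn_chart_symm (x := p))

theorem contDiffAt_chartOrbit [IsManifold 𝓘(ℝ, E) ∞ G] {p : G} (x : SmoothVec E ρ) {u : E}
    (hu : u ∈ (chartAt E p).target) : ContDiffAt ℝ ∞ (chartOrbit p x) u :=
  (contDiffOn_chartOrbit p x).contDiffAt ((chartAt E p).open_target.mem_nhds hu)

@[simp] theorem SmoothVec.val_add (x y : SmoothVec E ρ) : (x + y).val = x.val + y.val := rfl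
@[simp] theorem SmoothVec.val_sub (x y : SmoothVec E ρ) : (x - y).val = x.val - y.val := rfl
@[simp] theorem SmoothVec.val_zero : (0 : SmoothVec E ρ).val = 0 := rfl
@[simp] theorem SmoothVec.val_smul (c : ℂ) (x : SmoothVec E ρ) : (c • x).val = c • x.val := rfl
@[simp] theorem SmoothVec.val_real_smul (c : ℝ) (x : SmoothVec E ρ) : (c • x).val = c • x.val := rfl

theorem SmoothVec.ext {x y : SmoothVec E ρ} (h : x.val = y.val) : x = y := Subtype.ext h

theorem chartOrbit_add (p : G) (x y : SmoothVec E ρ) :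
    chartOrbit p (x + y) = chartOrbit p x + chartOrbit p y := by
  ext u; simp [chartOrbit]

theorem chartOrbit_sub (p : G) (x y : SmoothVec E ρ) :
    chartOrbit p (x - y) = chartOrbit p x - chartOrbit p y := by
  ext u; simp [chartOrbit]

theorem chartOrbit_smul (p : G) (c : ℝ) (x : SmoothVec E ρ) :
    chartOrbit p (c • x) = c • chartOrbit p x := by
  ext u
  simp only [chartOrbit, SmoothVec.val_real_smul, Pi.smul_apply]
  exact ((ρ ((chartAt E p).symm u)).toLinearEquiv.toLinearMap.restrictScalars ℝ).map_smul c x.val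

variable [LieGroup 𝓘(ℝ, E) ∞ G]

theorem tendsto_smoothVec_iff_sub {ι : Type*} {l : Filter ι} {a : ι → SmoothVec E ρ}
    {x : SmoothVec E ρ} : Filter.Tendsto a l (𝓝 x) ↔
      ∀ (p : G) (k : ℕ) (K : Set E), IsCompact K → K ⊆ (chartAt E p).target →
        ∀ ε > 0, ∀ᶠ i in l, ∀ u ∈ K, ‖iteratedFDeriv ℝ k (chartOrbit p (a i - x)) u‖ < ε := by
  rw [tendsto_smoothVec_iff]
  refine forall₄_congr fun p k K hK => forall_congr' fun hKp => ?_
  rw [Metric.tendstoUniformlyOn_iff]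
  refine forall₂_congr fun ε _ => Filter.eventually_congr (Filter.Eventually.of_forall fun i =>
    forall₂_congr fun u hu => ?_)
  have h1 := (contDiffAt_chartOrbit (a i) (hKp hu)).of_le (m := k) (by exact_mod_cast le_top)
  have h2 := (contDiffAt_chartOrbit x (hKp hu)).of_le (m := k) (by exact_mod_cast le_top)
  rw [chartOrbit_sub, iteratedFDeriv_sub_apply h1 h2, dist_comm, dist_eq_norm]

theorem exists_norm_iteratedFDeriv_le (p : G) (k : ℕ) {K : Set E} (hK : IsCompact K)
    (hKp : K ⊆ (chartAt E p).target) (x : SmoothVec E ρ) :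
    ∃ C, 0 < C ∧ ∀ u ∈ K, ‖iteratedFDeriv ℝ k (chartOrbit p x) u‖ ≤ C := by
  have h : ContinuousOn (iteratedFDeriv ℝ k (chartOrbit p x)) K := fun u hu =>
    ((contDiffAt_chartOrbit x (hKp hu)).continuousAt_iteratedFDeriv
      (by exact_mod_cast le_top)).continuousWithinAt
  obtain ⟨C, hC⟩ := hK.exists_bound_of_continuousOn h
  exact ⟨max C 1, by positivity, fun u hu => (hC u hu).trans (le_max_left _ _)⟩

instance : ContinuousAdd (SmoothVec E ρ) where
  continuous_add := by
    refine continuous_iff_continuousAt.2 fun ⟨x, y⟩ => ?_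
    refine tendsto_smoothVec_iff_sub.2 fun p k K hK hKp ε hε => ?_
    have h1 := tendsto_smoothVec_iff_sub.1 (continuous_fst.tendsto (x, y)) p k K hK hKp (ε / 2)
      (by positivity)
    have h2 := tendsto_smoothVec_iff_sub.1 (continuous_snd.tendsto (x, y)) p k K hK hKp (ε / 2)
      (by positivity)
    filter_upwards [h1, h2] with ⟨a, b⟩ ha hb u hu
    have ha' := contDiffAt_chartOrbit (a - x) (hKp hu) |>.of_le (m := k) (by exact_mod_cast le_top)
    have hb' := contDiffAt_chartOrbit (b - y) (hKp hu) |>.of_le (m := k) (by exact_mod_cast le_top)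
    have h3 : a + b - (x + y) = (a - x) + (b - y) := by abel
    rw [h3, chartOrbit_add, iteratedFDeriv_add_apply ha' hb']
    have := ha u hu
    have := hb u hu
    have := norm_add_le (iteratedFDeriv ℝ k (chartOrbit p (a - x)) u)
      (iteratedFDeriv ℝ k (chartOrbit p (b - y)) u)
    dsimp only at *
    linarith

instance : ContinuousSMul ℝ (SmoothVec E ρ) where
  continuous_smul := by
    refine continuous_iff_continuousAt.2 fun ⟨r, x⟩ => ?_
    refine tendsto_smoothVec_iff_sub.2 fun p k K hK hKp ε hε => ?_
    obtain ⟨C, hC, hCx⟩ := exists_norm_iteratedFDeriv_le p k hK hKp x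
    have h1 := tendsto_smoothVec_iff_sub.1 (continuous_snd.tendsto (r, x)) p k K hK hKp
      (ε / (2 * (|r| + 1))) (by positivity)
    have h2 := Metric.tendsto_nhds.1 (continuous_fst.tendsto (r, x)) (min 1 (ε / (2 * C)))
      (by positivity)
    filter_upwards [h1, h2] with ⟨s, a⟩ ha hs u hu
    have ha' := contDiffAt_chartOrbit (a - x) (hKp hu) |>.of_le (m := k) (by exact_mod_cast le_top)
    have hb' := contDiffAt_chartOrbit x (hKp hu) |>.of_le (m := k) (by exact_mod_cast le_top)
    have h3 : s • a - r • x = s • (a - x) + (s - r) • x := by module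
    dsimp only at ha hs ⊢
    rw [h3, chartOrbit_add, chartOrbit_smul, chartOrbit_smul,
      iteratedFDeriv_add_apply (f := s • chartOrbit p (a - x)) (g := (s - r) • chartOrbit p x)
        (ha'.const_smul s) (hb'.const_smul (s - r)),
      iteratedFDeriv_const_smul_apply ha', iteratedFDeriv_const_smul_apply hb']
    refine (norm_add_le _ _).trans_lt ?_
    rw [norm_smul, norm_smul, Real.norm_eq_abs, Real.norm_eq_abs]
    have h4 := ha u hu
    have h5 := hCx u hu
    rw [Real.dist_eq] at hs
    have hs1 := hs.trans_le (min_le_left _ _)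
    have hs2 := hs.trans_le (min_le_right _ _)
    have hs3 : |s| ≤ |r| + 1 := by
      have := abs_sub_abs_le_abs_sub s r
      linarith
    have e1 : (|r| + 1) * (ε / (2 * (|r| + 1))) = ε / 2 := by field_simp
    have e2 : ε / (2 * C) * C = ε / 2 := by field_simp
    have i1 : |s| * ‖iteratedFDeriv ℝ k (chartOrbit p (a - x)) u‖ ≤ ε / 2 := by
      rw [← e1]; gcongr
    have i2 : |s - r| * ‖iteratedFDeriv ℝ k (chartOrbit p x) u‖ < ε / 2 := by
      calc _ ≤ |s - r| * C := by gcongr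
        _ < _ := by rw [← e2]; gcongr
    linarith

/-- The inclusion of `H_∞` into `H`, as a continuous real linear map. -/
def valL (ρ : G →* (H ≃ₗᵢ[ℂ] H)) : SmoothVec E ρ →L[ℝ] H where
  toFun := SmoothVec.val
  map_add' _ _ := rfl
  map_smul' _ _ := rfl
  cont := by
    refine continuous_iff_continuousAt.2 fun x => ?_
    have h1 := tendsto_smoothVec_iff_sub.1 (continuous_id.tendsto x) 1 0 {chartAt E (1 : G) 1}
      isCompact_singleton (by simp)
    refine Metric.tendsto_nhds.2 fun ε hε => ?_
    filter_upwards [h1 ε hε] with a ha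
    have := ha _ rfl
    rw [norm_iteratedFDeriv_zero, chartOrbit, (chartAt E (1 : G)).left_inv (mem_chart_source E 1),
      (ρ 1).norm_map] at this
    rwa [dist_eq_norm]

end Topology

/-! ### Vector fields in charts -/

section VectorField

open VectorField

variable {E : Type*} [NormedAddCommGroup E] [NormedSpace ℝ E]
  {G : Type*} [TopologicalSpace G] [ChartedSpace E G]
  {F : Type*} [NormedAddCommGroup F] [NormedSpace ℝ F]

/-- The representative of a vector field in the preferred chart at `p`. -/
def chartField (p : G) (V : Π g : G, TangentSpace 𝓘(ℝ, E) g) : E → E :=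
  mpullbackWithin 𝓘(ℝ, E) 𝓘(ℝ, E) (extChartAt 𝓘(ℝ, E) p).symm V (Set.range 𝓘(ℝ, E))

/-- The representative of a function in the preferred chart at `p`. -/
def chartFun (p : G) (f : G → F) : E → F := f ∘ (extChartAt 𝓘(ℝ, E) p).symm

/-- The derivative of a function with values in a vector space at a point of a manifold; in contrast
to `mfderiv`, its type does not mention tangent spaces. -/
def vecDeriv (E : Type*) [NormedAddCommGroup E] [NormedSpace ℝ E]
    [ChartedSpace E G] (f : G → F) (g : G) : E →L[ℝ] F := mfderiv 𝓘(ℝ, E) 𝓘(ℝ, F) f g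

theorem fderiv_chartFun_chartField [IsManifold 𝓘(ℝ, E) 1 G] {p : G} {f : G → F}
    {V : Π g : G, TangentSpace 𝓘(ℝ, E) g} {u : E} (hu : u ∈ (extChartAt 𝓘(ℝ, E) p).target)
    (hf : MDifferentiableAt 𝓘(ℝ, E) 𝓘(ℝ, F) f ((extChartAt 𝓘(ℝ, E) p).symm u)) :
    fderiv ℝ (chartFun p f) u (chartField p V u) =
      vecDeriv E f ((extChartAt 𝓘(ℝ, E) p).symm u) (V ((extChartAt 𝓘(ℝ, E) p).symm u)) := by
  have hinv := isInvertible_mfderivWithin_extChartAt_symm hu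
  have hd : MDifferentiableAt 𝓘(ℝ, E) 𝓘(ℝ, E) (extChartAt 𝓘(ℝ, E) p).symm u := by
    have := mdifferentiableWithinAt_extChartAt_symm hu
    simpa [mdifferentiableWithinAt_univ] using this
  have h := mfderiv_comp u hf hd
  rw [← mfderiv_eq_fderiv, chartFun, h, vecDeriv, chartField, mpullbackWithin_apply]
  change mfderiv 𝓘(ℝ, E) 𝓘(ℝ, F) f ((extChartAt 𝓘(ℝ, E) p).symm u) _ = _
  congr 1
  rw [← mfderivWithin_univ]
  obtain ⟨e, he⟩ := hinv
  rw [modelWithCornersSelf_coe, Set.range_id] at he ⊢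
  rw [← he, ContinuousLinearMap.inverse_equiv]
  exact e.apply_symm_apply _

theorem contDiffOn_chartField [CompleteSpace E] [IsManifold 𝓘(ℝ, E) ∞ G] (p : G)
    {V : Π g : G, TangentSpace 𝓘(ℝ, E) g}
    (hV : ContMDiff 𝓘(ℝ, E) 𝓘(ℝ, E).tangent ∞ fun g => (V g : TangentBundle 𝓘(ℝ, E) G)) :
    ContDiffOn ℝ ∞ (chartField p V) (extChartAt 𝓘(ℝ, E) p).target := by
  have : IsManifold 𝓘(ℝ, E) 1 G := IsManifold.of_le (n := ∞) (by simp)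
  intro u hu
  have h := ContMDiffWithinAt.mpullbackWithin_vectorField_of_mem (m := ∞) (n := ∞)
    (f := (extChartAt 𝓘(ℝ, E) p).symm) (s := Set.range 𝓘(ℝ, E)) (t := Set.univ)
    (hV _).contMDiffWithinAt
    (contMDiffWithinAt_extChartAt_symm_range p hu) (isInvertible_mfderivWithin_extChartAt_symm hu)
    (by simp) (by simpa using uniqueMDiffOn_univ) (by simp) (by simp)
  have h2 := (contMDiff_snd_tangentBundle_modelSpace E 𝓘(ℝ, E)).contMDiffAt.comp_contMDiffWithinAt
    _ h
  exact (contMDiffWithinAt_iff_contDiffWithinAt.1 h2).mono (by simp)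

/-- The Lie bracket of vector fields is the commutator of derivations. The derivatives of `f` in
the directions `V` and `W` are given as functions `fV` and `fW`. -/
theorem mfderiv_mlieBracket [CompleteSpace E] [IsManifold 𝓘(ℝ, E) ∞ G]
    {V W : Π g : G, TangentSpace 𝓘(ℝ, E) g}
    (hV : ContMDiff 𝓘(ℝ, E) 𝓘(ℝ, E).tangent ∞ fun g => (V g : TangentBundle 𝓘(ℝ, E) G))
    (hW : ContMDiff 𝓘(ℝ, E) 𝓘(ℝ, E).tangent ∞ fun g => (W g : TangentBundle 𝓘(ℝ, E) G))
    {f fV fW : G → F} (hf : ContMDiff 𝓘(ℝ, E) 𝓘(ℝ, F) ∞ f)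
    (hfV : ∀ g, vecDeriv E f g (V g) = fV g)
    (hfW : ∀ g, vecDeriv E f g (W g) = fW g)
    (hfV' : MDifferentiable 𝓘(ℝ, E) 𝓘(ℝ, F) fV) (hfW' : MDifferentiable 𝓘(ℝ, E) 𝓘(ℝ, F) fW)
    (x₀ : G) :
    vecDeriv E f x₀ (mlieBracket 𝓘(ℝ, E) V W x₀) =
      vecDeriv E fW x₀ (V x₀) - vecDeriv E fV x₀ (W x₀) := by
  have : IsManifold 𝓘(ℝ, E) 1 G := IsManifold.of_le (n := ∞) (by simp)
  set φ := extChartAt 𝓘(ℝ, E) x₀ with hφ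
  set u := φ x₀
  have hu : u ∈ φ.target := mem_extChartAt_target x₀
  have hux : φ.symm u = x₀ := extChartAt_to_inv x₀
  have hnhds : φ.target ∈ 𝓝 u := extChartAt_target_mem_nhds x₀
  have hA : ContDiffAt ℝ ∞ (chartField x₀ V) u := (contDiffOn_chartField x₀ hV).contDiffAt hnhds
  have hB : ContDiffAt ℝ ∞ (chartField x₀ W) u := (contDiffOn_chartField x₀ hW).contDiffAt hnhds
  have hF : ContDiffAt ℝ ∞ (chartFun x₀ f) u := by
    have h := (hf.comp_contMDiffOn (contMDiffOn_extChartAt_symm (I := 𝓘(ℝ, E)) (n := ∞) x₀))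
    exact (contMDiffOn_iff_contDiffOn.1 h).contDiffAt hnhds
  have hmd : MDifferentiable 𝓘(ℝ, E) 𝓘(ℝ, F) f := hf.mdifferentiable (by simp)
  have hFV : chartFun x₀ fV =ᶠ[𝓝 u]
      fun v => fderiv ℝ (chartFun x₀ f) v (chartField x₀ V v) := by
    filter_upwards [hnhds] with v hv
    exact ((fderiv_chartFun_chartField hv (hmd _)).trans (hfV _)).symm
  have hFW : chartFun x₀ fW =ᶠ[𝓝 u]
      fun v => fderiv ℝ (chartFun x₀ f) v (chartField x₀ W v) := by
    filter_upwards [hnhds] with v hv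
    exact ((fderiv_chartFun_chartField hv (hmd _)).trans (hfW _)).symm
  have hdF : DifferentiableAt ℝ (fderiv ℝ (chartFun x₀ f)) u :=
    (hF.fderiv_right (m := 1) (by norm_cast)).differentiableAt (by simp)
  have e1 := fderiv_chartFun_chartField (p := x₀) (f := fW) (V := V) hu (hfW' _)
  have e2 := fderiv_chartFun_chartField (p := x₀) (f := fV) (V := W) hu (hfV' _)
  rw [hFW.fderiv_eq, fderiv_clm_apply hdF (hB.differentiableAt (by simp))] at e1
  rw [hFV.fderiv_eq, fderiv_clm_apply hdF (hA.differentiableAt (by simp))] at e2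
  have hsymm : IsSymmSndFDerivAt ℝ (chartFun x₀ f) u := hF.isSymmSndFDerivAt (by simp; norm_cast)
  have e3 : vecDeriv E f x₀ (mlieBracket 𝓘(ℝ, E) V W x₀) =
      fderiv ℝ (chartFun x₀ f) u
        (VectorField.lieBracket ℝ (chartField x₀ V) (chartField x₀ W) u) := by
    have h1 : f =ᶠ[𝓝 x₀] chartFun x₀ f ∘ φ := by
      filter_upwards [extChartAt_source_mem_nhds (I := 𝓘(ℝ, E)) x₀] with g hg
      exact congrArg f (φ.left_inv hg).symm
    have h2 : MDifferentiableAt 𝓘(ℝ, E) 𝓘(ℝ, F) (chartFun x₀ f) (φ x₀) :=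
      (hF.differentiableAt (by simp)).mdifferentiableAt
    have h3 := mfderiv_comp x₀ h2 (mdifferentiableAt_extChartAt (mem_chart_source E x₀))
    rw [vecDeriv, h1.mfderiv_eq, h3, mfderiv_eq_fderiv, ← mlieBracketWithin_univ,
      mlieBracketWithin_apply]
    change fderiv ℝ (chartFun x₀ f) u (mfderiv 𝓘(ℝ, E) 𝓘(ℝ, E) φ x₀ _) = _
    obtain ⟨e, he⟩ := isInvertible_mfderiv_extChartAt (I := 𝓘(ℝ, E)) (mem_extChartAt_source x₀)
    rw [← he, ContinuousLinearMap.inverse_equiv]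
    refine congrArg _ ((e.apply_symm_apply _).trans ?_)
    change lieBracketWithin ℝ (chartField x₀ V) (chartField x₀ W)
      (φ.symm ⁻¹' Set.univ ∩ Set.range 𝓘(ℝ, E)) u = _
    rw [Set.preimage_univ, Set.univ_inter, modelWithCornersSelf_coe, Set.range_id,
      lieBracketWithin_univ]
  rw [hux] at e1 e2
  rw [e3, ← e1, ← e2, lieBracket_eq]
  simp only [map_sub, add_apply, ContinuousLinearMap.flip_apply,
    ContinuousLinearMap.comp_apply]
  rw [hsymm.eq (chartField x₀ V u) (chartField x₀ W u)]
  abel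

end VectorField

/-! ### Invariant vector fields and one-parameter subgroups -/

section Group

open VectorField

variable {E : Type*} [NormedAddCommGroup E] [NormedSpace ℝ E]
  {G : Type*} [TopologicalSpace G] [ChartedSpace E G] [Group G]

/-- The derivative of a map of `G` to itself, as an endomorphism of the model space. -/
def groupDeriv (E : Type*) [NormedAddCommGroup E] [NormedSpace ℝ E] {G : Type*} [TopologicalSpace G]
    [ChartedSpace E G] (f : G → G) (g : G) : E →L[ℝ] E := mfderiv 𝓘(ℝ, E) 𝓘(ℝ, E) f g

omit [Group G] in
theorem groupDeriv_comp {f φ : G → G} {g g' : G} (h : f g = g')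
    (hφ : MDifferentiableAt 𝓘(ℝ, E) 𝓘(ℝ, E) φ g') (hf : MDifferentiableAt 𝓘(ℝ, E) 𝓘(ℝ, E) f g) :
    groupDeriv E (φ ∘ f) g = (groupDeriv E φ g').comp (groupDeriv E f g) := by
  subst h
  exact mfderiv_comp g hφ hf

omit [Group G] in
theorem vecDeriv_comp {F : Type*} [NormedAddCommGroup F] [NormedSpace ℝ F] {f : G → G} {φ : G → F}
    {g g' : G} (h : f g = g')
    (hφ : MDifferentiableAt 𝓘(ℝ, E) 𝓘(ℝ, F) φ g') (hf : MDifferentiableAt 𝓘(ℝ, E) 𝓘(ℝ, E) f g) :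
    vecDeriv E (φ ∘ f) g = (vecDeriv E φ g').comp (groupDeriv E f g) := by
  subst h
  exact mfderiv_comp g hφ hf

/-- The left invariant vector field with value `X` at `e`. -/
def leftField (X : LieAlg E G) : Π g : G, TangentSpace 𝓘(ℝ, E) g :=
  mulInvariantVectorField (I := 𝓘(ℝ, E)) X

theorem leftField_apply (X : LieAlg E G) (g : G) :
    leftField X g = groupDeriv E (g * ·) (1 : G) X := rfl

variable [LieGroup 𝓘(ℝ, E) ∞ G]

/-- The case of finite smoothness is `contMDiff_mulInvariantVectorField`. -/
theorem contMDiff_leftField (X : LieAlg E G) :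
    ContMDiff 𝓘(ℝ, E) 𝓘(ℝ, E).tangent ∞
      fun g : G => (leftField X g : TangentBundle 𝓘(ℝ, E) G) := by
  have : IsManifold 𝓘(ℝ, E) 1 G := IsManifold.of_le (n := ∞) (by simp)
  let I := 𝓘(ℝ, E)
  let fg : G → TangentBundle I G := fun g => Bundle.TotalSpace.mk' E g 0
  have sfg : ContMDiff I I.tangent ∞ fg := Bundle.contMDiff_zeroSection _ _
  let fv : G → TangentBundle I G := fun _ => Bundle.TotalSpace.mk' E 1 X
  have sfv : ContMDiff I I.tangent ∞ fv := contMDiff_const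
  let F₁ : G → (TangentBundle I G × TangentBundle I G) := fun g => (fg g, fv g)
  have S₁ : ContMDiff I (I.tangent.prod I.tangent) ∞ F₁ := sfg.prodMk sfv
  let F₂ : (TangentBundle I G × TangentBundle I G) → TangentBundle (I.prod I) (G × G) :=
    (equivTangentBundleProd I G I G).symm
  have S₂ : ContMDiff (I.tangent.prod I.tangent) (I.prod I).tangent ∞ F₂ :=
    contMDiff_equivTangentBundleProd_symm
  let F₃ : TangentBundle (I.prod I) (G × G) → TangentBundle I G :=
    tangentMap (I.prod I) I (fun p : G × G => p.1 * p.2)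
  have S₃ : ContMDiff (I.prod I).tangent I.tangent ∞ F₃ :=
    ContMDiff.contMDiff_tangentMap (contMDiff_mul I ∞) (m := ∞) (by simp)
  convert! (S₃.comp S₂).comp S₁ with g
  · simp [F₁, F₂, F₃, fg, fv]
  · simp only [Function.comp_apply, tangentMap, F₃, F₂, F₁, fg, fv]
    rw [mfderiv_prod_eq_add_apply ((contMDiff_mul I ∞).mdifferentiableAt (by simp))]
    exact ((congrArg (· + _) (map_zero _)).trans (zero_add _)).symm

theorem mfderiv_mul_left_leftField (X : LieAlg E G) (g h : G) :
    groupDeriv E (g * ·) h (leftField X h) = leftField X (g * h) := by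
  have h1 : MDifferentiableAt 𝓘(ℝ, E) 𝓘(ℝ, E) (g * · : G → G) h :=
    (contMDiff_mul_left (n := ∞)).mdifferentiableAt (by simp)
  have h2 : MDifferentiableAt 𝓘(ℝ, E) 𝓘(ℝ, E) (h * · : G → G) 1 :=
    (contMDiff_mul_left (n := ∞)).mdifferentiableAt (by simp)
  have h3 := groupDeriv_comp (mul_one h) h1 h2
  have h4 : (fun a : G => g * a) ∘ (fun a : G => h * a) = fun a => g * h * a := by
    ext a; simp [mul_assoc]
  rw [h4] at h3
  rw [leftField_apply, leftField_apply, h3]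
  rfl

/-- Left translates of integral curves of a left invariant vector field are integral curves. -/
theorem IsMIntegralCurveOn.mul_left {X : LieAlg E G} {γ : ℝ → G} {s : Set ℝ}
    (hγ : IsMIntegralCurveOn γ (leftField X) s) (g : G) :
    IsMIntegralCurveOn (fun t => g * γ t) (leftField X) s := fun t ht => by
  have h1 : HasMFDerivAt 𝓘(ℝ, E) 𝓘(ℝ, E) (g * · : G → G) (γ t) _ :=
    ((contMDiff_mul_left (n := ∞)).mdifferentiableAt (by simp)).hasMFDerivAt
  have h2 := h1.comp_hasMFDerivWithinAt t (hγ t ht)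
  refine h2.congr_mfderiv ?_
  rw [← mfderiv_mul_left_leftField]
  refine ContinuousLinearMap.ext fun (r : ℝ) => ?_
  exact (groupDeriv E (g * ·) (γ t)).map_smul r (leftField X (γ t))

/-- Left invariant vector fields are complete: by left translation, an existence time at `e` serves
at all points. -/
theorem exists_isMIntegralCurve_leftField [CompleteSpace E] [T2Space G] (X : LieAlg E G) :
    ∃ γ : ℝ → G, γ 0 = 1 ∧ IsMIntegralCurve γ (leftField X) := by
  have : IsManifold 𝓘(ℝ, E) 1 G := IsManifold.of_le (n := ∞) (by simp)
  have hX : ContMDiff 𝓘(ℝ, E) 𝓘(ℝ, E).tangent 1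
      fun g : G => (leftField X g : TangentBundle 𝓘(ℝ, E) G) :=
    (contMDiff_leftField X).of_le (by simp)
  obtain ⟨γ, h0, hγ⟩ := exists_isMIntegralCurveAt_of_contMDiffAt_boundaryless (t₀ := 0)
    (hX.contMDiffAt (x := 1))
  obtain ⟨ε, hε, hγ⟩ := (isMIntegralCurveAt_iff'.1 hγ)
  rw [Real.ball_eq_Ioo, zero_sub, zero_add] at hγ
  refine exists_isMIntegralCurve_of_isMIntegralCurveOn hX hε (fun g => ?_) 1
  exact ⟨fun t => g * γ t, by simp [h0], IsMIntegralCurveOn.mul_left hγ g⟩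

/-- The integral curve through `e` of a left invariant vector field is a one-parameter subgroup. -/
theorem IsMIntegralCurve.map_add [T2Space G] {X : LieAlg E G} {γ : ℝ → G}
    (hγ : IsMIntegralCurve γ (leftField X)) (h0 : γ 0 = 1) (s t : ℝ) :
    γ (s + t) = γ s * γ t := by
  have : IsManifold 𝓘(ℝ, E) 1 G := IsManifold.of_le (n := ∞) (by simp)
  have hX : ContMDiff 𝓘(ℝ, E) 𝓘(ℝ, E).tangent 1
      fun g : G => (leftField X g : TangentBundle 𝓘(ℝ, E) G) :=
    (contMDiff_leftField X).of_le (by simp)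
  have h1 := hγ.comp_add s
  have h2 : IsMIntegralCurve (fun t => γ s * γ t) (leftField X) :=
    isMIntegralCurve_iff_isMIntegralCurveOn.2
      (IsMIntegralCurveOn.mul_left (isMIntegralCurve_iff_isMIntegralCurveOn.1 hγ) _)
  have h3 := isMIntegralCurve_Ioo_eq_of_contMDiff_boundaryless (t₀ := 0) hX h1 h2 (by simp [h0])
  simpa [add_comm] using congrFun h3 t

/-! ### The Lie bracket -/

theorem mdifferentiable_inv : MDifferentiable 𝓘(ℝ, E) 𝓘(ℝ, E) (fun g : G => g⁻¹) :=
  (contMDiff_inv 𝓘(ℝ, E) ∞).mdifferentiable (by simp)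

theorem groupDeriv_inv_one (X : LieAlg E G) : groupDeriv E (fun g : G => g⁻¹) 1 X = -X := by
  have hmul : MDifferentiableAt (𝓘(ℝ, E).prod 𝓘(ℝ, E)) 𝓘(ℝ, E) (fun p : G × G => p.1 * p.2)
      (1, 1) := (contMDiff_mul 𝓘(ℝ, E) ∞).mdifferentiableAt (by simp)
  have h1 := mfderiv_comp_of_eq (x := (1 : G)) (f := fun g : G => (g, g⁻¹)) hmul
    (mdifferentiableAt_id.prodMk (mdifferentiable_inv (E := E) 1)) (by simp)
  have h2 : (fun p : G × G => p.1 * p.2) ∘ (fun g : G => (g, g⁻¹)) = fun _ => 1 := by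
    ext; simp
  rw [h2, mfderiv_const] at h1
  have h8 : (mfderiv 𝓘(ℝ, E) (𝓘(ℝ, E).prod 𝓘(ℝ, E)) (fun g : G => (g, g⁻¹)) 1 X : E × E) =
      (X, groupDeriv E (fun g : G => g⁻¹) 1 X) :=
    (DFunLike.congr_fun
      (mdifferentiableAt_id.mfderiv_prod (mdifferentiable_inv (E := E) 1)) X).trans
      (Prod.ext (DFunLike.congr_fun (mfderiv_id (I := 𝓘(ℝ, E)) (x := (1 : G))) X) rfl)
  -- the derivative of `(g, h) ↦ g * h` at `(1, 1)` is the sum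
  let T : E × E →L[ℝ] E := mfderiv (𝓘(ℝ, E).prod 𝓘(ℝ, E)) 𝓘(ℝ, E)
    (fun p : G × G => p.1 * p.2) (1, 1)
  have h3 : (0 : E) = T (X, groupDeriv E (fun g : G => g⁻¹) 1 X) := by
    have h4 := DFunLike.congr_fun h1 X
    let S : G → (E × E →L[ℝ] E) := fun a => mfderiv (𝓘(ℝ, E).prod 𝓘(ℝ, E)) 𝓘(ℝ, E)
      (fun p : G × G => p.1 * p.2) (1, a)
    have h5 : S 1⁻¹ = T := congrArg S inv_one
    rw [← h5, ← h8]
    exact h4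
  have h6 : ∀ v : E × E, T v = groupDeriv E (fun z : G => z * 1) 1 v.1 +
      groupDeriv E (fun z : G => 1 * z) 1 v.2 :=
    fun v => mfderiv_prod_eq_add_apply (v := v) hmul
  have h7 : groupDeriv E (fun z : G => z) 1 = ContinuousLinearMap.id ℝ E := mfderiv_id
  rw [h6] at h3
  simp only [mul_one, one_mul, h7, ContinuousLinearMap.id_apply] at h3
  exact eq_neg_of_add_eq_zero_right h3.symm

theorem groupDeriv_inv_rightInvariantField (X : LieAlg E G) (g : G) :
    groupDeriv E (fun g : G => g⁻¹) g (rightInvariantField X g) = leftField (-X) g⁻¹ := by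
  have h1 : MDifferentiableAt 𝓘(ℝ, E) 𝓘(ℝ, E) (· * g : G → G) 1 :=
    (contMDiff_mul_right (n := ∞)).mdifferentiableAt (by simp)
  have h2 : MDifferentiableAt 𝓘(ℝ, E) 𝓘(ℝ, E) (g⁻¹ * · : G → G) 1 :=
    (contMDiff_mul_left (n := ∞)).mdifferentiableAt (by simp)
  have h3 := groupDeriv_comp (f := (· * g)) (one_mul g) (mdifferentiable_inv g) h1
  have h4 := groupDeriv_comp inv_one h2 (mdifferentiable_inv 1)
  have h5 : (fun g : G => g⁻¹) ∘ (· * g : G → G) = (g⁻¹ * · : G → G) ∘ (fun g : G => g⁻¹) := by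
    ext; simp
  rw [h5, h4] at h3
  exact (DFunLike.congr_fun h3 X).symm.trans
    (congrArg (groupDeriv E (g⁻¹ * ·) (1 : G)) (groupDeriv_inv_one X))

theorem groupDeriv_inv_comp_groupDeriv_inv (g : G) : (groupDeriv E (fun g : G => g⁻¹) g⁻¹).comp
    (groupDeriv E (fun g : G => g⁻¹) g) = ContinuousLinearMap.id ℝ E := by
  have h : (fun g : G => g⁻¹) ∘ (fun g : G => g⁻¹) = id := by ext; simp
  rw [← groupDeriv_comp rfl (mdifferentiable_inv _) (mdifferentiable_inv g), h]
  exact mfderiv_id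

theorem isInvertible_mfderiv_inv (g : G) :
    (mfderiv 𝓘(ℝ, E) 𝓘(ℝ, E) (fun g : G => g⁻¹) g).IsInvertible := by
  have h := groupDeriv_inv_comp_groupDeriv_inv (E := E) g⁻¹
  rw [inv_inv] at h
  exact ContinuousLinearMap.IsInvertible.of_inverse
    (g := mfderiv 𝓘(ℝ, E) 𝓘(ℝ, E) (fun g : G => g⁻¹) g⁻¹) h
    (groupDeriv_inv_comp_groupDeriv_inv (E := E) g)

theorem mpullback_inv_leftField (X : LieAlg E G) :
    mpullback 𝓘(ℝ, E) 𝓘(ℝ, E) (fun g : G => g⁻¹) (leftField (-X)) = rightInvariantField X := by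
  ext g
  rw [mpullback_apply]
  obtain ⟨e, he⟩ := isInvertible_mfderiv_inv (E := E) g
  have h : (e (rightInvariantField (E := E) X g) : E) = leftField (E := E) (-X) g⁻¹ :=
    (DFunLike.congr_fun he _).trans (groupDeriv_inv_rightInvariantField X g)
  rw [← he, ContinuousLinearMap.inverse_equiv]
  exact e.symm_apply_eq.2 h.symm

theorem mdifferentiableAt_leftField (X : LieAlg E G) (g : G) :
    MDifferentiableAt 𝓘(ℝ, E) 𝓘(ℝ, E).tangent
      (fun g : G => (leftField X g : TangentBundle 𝓘(ℝ, E) G)) g :=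
  (contMDiff_leftField X).mdifferentiableAt (by simp)

omit [LieGroup 𝓘(ℝ, E) ∞ G] in
theorem leftField_smul (c : ℝ) (X : LieAlg E G) :
    leftField (G := G) (c • X) = c • leftField X :=
  mulInvariantVectorField_smul (I := 𝓘(ℝ, E)) c X

omit [LieGroup 𝓘(ℝ, E) ∞ G] in
theorem leftField_add (X Y : LieAlg E G) :
    leftField (G := G) (X + Y) = leftField X + leftField Y :=
  mulInvariantVectorField_add (I := 𝓘(ℝ, E)) X Y

/-- Inversion exchanges left and right invariant fields, so that the two brackets on `𝔤` are
opposite. -/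
theorem lieBracket_eq_neg [CompleteSpace E] (X Y : LieAlg E G) :
    lieBracket (G := G) X Y =
      -(mlieBracket 𝓘(ℝ, E) (leftField X) (leftField (G := G) Y) (1 : G) : E) := by
  have : LieGroup 𝓘(ℝ, E) (minSmoothness ℝ 3) G := LieGroup.of_le (n := ∞) (by simp; norm_cast)
  have : IsManifold 𝓘(ℝ, E) (minSmoothness ℝ 2) G := IsManifold.of_le (n := ∞) (by simp; norm_cast)
  have h1 := mpullback_mlieBracket (f := fun g : G => g⁻¹) (x₀ := 1) (n := ∞)
    (mdifferentiableAt_leftField (-X) _)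
    (mdifferentiableAt_leftField (-Y) _)
    (contMDiff_inv 𝓘(ℝ, E) ∞ 1) (by simp; norm_cast)
  rw [mpullback_inv_leftField, mpullback_inv_leftField, mpullback_apply] at h1
  obtain ⟨e, he⟩ := isInvertible_mfderiv_inv (E := E) (1 : G)
  rw [lieBracket, ← h1, ← he, ContinuousLinearMap.inverse_equiv]
  refine e.injective ((e.apply_symm_apply _).trans ?_)
  have h2 : ∀ v : E, (e v : E) = -v := fun v =>
    (DFunLike.congr_fun he v).trans (groupDeriv_inv_one (G := G) v)
  refine Eq.trans ?_ ((h2 _).trans (neg_neg _)).symm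
  have h3 : ∀ Z : LieAlg E G, leftField (G := G) (-Z) = (-1 : ℝ) • leftField Z := fun Z => by
    rw [← neg_one_smul ℝ Z, leftField_smul]
  have h4 : ∀ a : G, mlieBracket 𝓘(ℝ, E) (leftField (-X)) (leftField (-Y)) a =
      mlieBracket 𝓘(ℝ, E) (leftField X) (leftField Y) a := fun a => by
    rw [h3, mlieBracket_const_smul_left (mdifferentiableAt_leftField X a), h3,
      mlieBracket_const_smul_right (mdifferentiableAt_leftField Y a)]
    simp
  exact (h4 _).trans
    (congrArg (fun a : G => (mlieBracket 𝓘(ℝ, E) (leftField X) (leftField Y) a : E)) inv_one)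

/-- The Lie bracket of `𝔤` as a bilinear map. -/
def lieBracketBilin (E : Type*) [NormedAddCommGroup E] [NormedSpace ℝ E] [CompleteSpace E]
    (G : Type*) [TopologicalSpace G] [ChartedSpace E G] [Group G] [LieGroup 𝓘(ℝ, E) ∞ G] :
    E →ₗ[ℝ] E →ₗ[ℝ] E :=
  have : IsManifold 𝓘(ℝ, E) 2 G := IsManifold.of_le (n := ∞) (by norm_cast)
  LinearMap.mk₂ ℝ (lieBracket (G := G))
    (fun X X' Y => by
      rw [lieBracket_eq_neg, lieBracket_eq_neg, lieBracket_eq_neg, leftField_add,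
        mlieBracket_add_left (mdifferentiableAt_leftField X _) (mdifferentiableAt_leftField X' _)]
      exact neg_add _ _)
    (fun c X Y => by
      rw [lieBracket_eq_neg, lieBracket_eq_neg, leftField_smul,
        mlieBracket_const_smul_left (mdifferentiableAt_leftField X _)]
      exact (smul_neg c _).symm)
    (fun X Y Y' => by
      rw [lieBracket_eq_neg, lieBracket_eq_neg, lieBracket_eq_neg, leftField_add,
        mlieBracket_add_right (mdifferentiableAt_leftField Y _) (mdifferentiableAt_leftField Y' _)]
      exact neg_add _ _)
    (fun c X Y => by
      rw [lieBracket_eq_neg, lieBracket_eq_neg, leftField_smul,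
        mlieBracket_const_smul_right (mdifferentiableAt_leftField Y _)]
      exact (smul_neg c _).symm)

end Group

/-! ### The infinitesimal representation -/

section Representation

variable {E : Type*} [NormedAddCommGroup E] [NormedSpace ℝ E]
  {G : Type*} [TopologicalSpace G] [ChartedSpace E G] [Group G] [LieGroup 𝓘(ℝ, E) ∞ G]
  {H : Type*} [NormedAddCommGroup H] [InnerProductSpace ℂ H]
  {ρ : G →* (H ≃ₗᵢ[ℂ] H)}

/-- The operator `ρ(g)` as a real continuous linear map. -/
def realOp (ρ : G →* (H ≃ₗᵢ[ℂ] H)) (g : G) : H →L[ℝ] H :=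
  (ρ g).toContinuousLinearEquiv.toContinuousLinearMap.restrictScalars ℝ

omit [TopologicalSpace G] [ChartedSpace E G] [LieGroup 𝓘(ℝ, E) ∞ G] in
@[simp] theorem realOp_apply (g : G) (x : H) : realOp ρ g x = ρ g x := rfl

/-- The orbit map `g ↦ ρ(g)x` of a smooth vector. -/
def orbitMap (x : SmoothVec E ρ) (g : G) : H := ρ g x.val

omit [LieGroup 𝓘(ℝ, E) ∞ G] in
theorem mdifferentiable_orbitMap (x : SmoothVec E ρ) :
    MDifferentiable 𝓘(ℝ, E) 𝓘(ℝ, H) (orbitMap x) :=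
  (contMDiff_orbit x).mdifferentiable (by simp)

theorem infRep_val (X : LieAlg E G) (x : SmoothVec E ρ) :
    (infRep ρ X x).val = vecDeriv E (orbitMap x) 1 X := rfl

omit [Group G] [LieGroup 𝓘(ℝ, E) ∞ G] in
theorem vecDeriv_clm_comp (L : H →L[ℝ] H) {f : G → H} {g : G}
    (hf : MDifferentiableAt 𝓘(ℝ, E) 𝓘(ℝ, H) f g) :
    vecDeriv E (L ∘ f) g = L.comp (vecDeriv E f g) := by
  have h := mfderiv_comp g L.mdifferentiableAt hf
  rw [mfderiv_eq_fderiv, ContinuousLinearMap.fderiv] at h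
  exact h

omit [LieGroup 𝓘(ℝ, E) ∞ G] in
theorem vecDeriv_orbitMap_act (g h : G) (x : SmoothVec E ρ) (X : E) :
    vecDeriv E (fun a => orbitMap x (g * a)) h X = ρ g (vecDeriv E (orbitMap x) h X) := by
  have h1 : (fun a => orbitMap x (g * a)) = realOp ρ g ∘ orbitMap x := by
    ext a; simp [orbitMap]
  rw [h1, vecDeriv_clm_comp _ (mdifferentiable_orbitMap x h)]
  rfl

/-- The left invariant field of `X` differentiates the orbit map of `x` to that of `ρ'(X)x`. -/
theorem vecDeriv_orbitMap_leftField (X : LieAlg E G) (x : SmoothVec E ρ) (g : G) :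
    vecDeriv E (orbitMap x) g (leftField X g) = orbitMap (infRep ρ X x) g := by
  have h1 := vecDeriv_comp (f := (g * ·)) (mul_one g) (mdifferentiable_orbitMap x g)
    ((contMDiff_mul_left (n := ∞)).mdifferentiableAt (by simp))
  rw [leftField_apply, orbitMap, infRep_val, ← vecDeriv_orbitMap_act g 1 x]
  exact (DFunLike.congr_fun h1 X).symm

omit [LieGroup 𝓘(ℝ, E) ∞ G] in
theorem leftField_one (X : LieAlg E G) : leftField (G := G) X 1 = X := by
  rw [leftField_apply]
  simp only [one_mul]
  exact DFunLike.congr_fun (mfderiv_id (I := 𝓘(ℝ, E)) (x := (1 : G))) X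

theorem infRep_lin_left (x : SmoothVec E ρ) (a b : ℝ) (X Y : LieAlg E G) :
    infRep ρ (a • X + b • Y) x = a • infRep ρ X x + b • infRep ρ Y x := by
  refine SmoothVec.ext ?_
  simp only [SmoothVec.val_add, SmoothVec.val_real_smul, infRep_val]
  rw [map_add, map_smul, map_smul]

theorem infRep_add_right (X : LieAlg E G) (x y : SmoothVec E ρ) :
    infRep ρ X (x + y) = infRep ρ X x + infRep ρ X y := by
  refine SmoothVec.ext ?_
  simp only [SmoothVec.val_add, infRep_val]
  have h : orbitMap (x + y) = orbitMap x + orbitMap y := by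
    ext g; simp [orbitMap]
  rw [h, vecDeriv, mfderiv_add (mdifferentiable_orbitMap x 1) (mdifferentiable_orbitMap y 1)]
  rfl

theorem infRep_smul_right (X : LieAlg E G) (c : ℝ) (x : SmoothVec E ρ) :
    infRep ρ X (c • x) = c • infRep ρ X x := by
  refine SmoothVec.ext ?_
  simp only [SmoothVec.val_real_smul, infRep_val]
  have h : orbitMap (c • x) = c • orbitMap x := by
    ext g
    exact (realOp ρ g).map_smul c x.val
  rw [h, vecDeriv, const_smul_mfderiv (mdifferentiable_orbitMap x 1)]
  rfl

/-- In a chart, `ρ'(X)` acts on orbit maps as a differential operator of first order with smooth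
coefficients. -/
theorem chartOrbit_infRep (p : G) (X : LieAlg E G) (x : SmoothVec E ρ) {u : E}
    (hu : u ∈ (chartAt E p).target) : chartOrbit p (infRep ρ X x) u =
      fderiv ℝ (chartOrbit p x) u (chartField p (leftField X) u) := by
  have : IsManifold 𝓘(ℝ, E) 1 G := IsManifold.of_le (n := ∞) (by simp)
  have h := fderiv_chartFun_chartField (p := p) (f := orbitMap x) (V := leftField X) (u := u)
    (by simpa using hu) (mdifferentiable_orbitMap x _)
  exact ((h.trans (vecDeriv_orbitMap_leftField X x _))).symm

variable [CompleteSpace E]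

/-- The derivatives of order `k` of the orbit map of `ρ'(X)x` are controlled on compact sets by those
of order `1, …, k + 1` of the orbit map of `x`. -/
theorem norm_iteratedFDeriv_chartOrbit_infRep_le (p : G) (X : LieAlg E G) (k : ℕ) {K : Set E}
    (hK : IsCompact K) (hKp : K ⊆ (chartAt E p).target) :
    ∃ C, 0 < C ∧ ∀ (x : SmoothVec E ρ) (u), u ∈ K → ∀ δ,
      (∀ i ∈ Finset.range (k + 1), ‖iteratedFDeriv ℝ (i + 1) (chartOrbit p x) u‖ ≤ δ) →
      ‖iteratedFDeriv ℝ k (chartOrbit p (infRep ρ X x)) u‖ ≤ C * δ := by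
  have ho := (chartAt E p).open_target
  set W := chartField p (leftField (G := G) X) with hWdef
  have hW : ContDiffOn ℝ ∞ W (chartAt E p).target := by
    simpa using contDiffOn_chartField p (contMDiff_leftField (G := G) X)
  have hb : ∀ i : ℕ, ∃ M, ∀ u ∈ K, ‖iteratedFDeriv ℝ (k - i) W u‖ ≤ M := fun i =>
    hK.exists_bound_of_continuousOn fun u hu =>
      ((hW.contDiffAt (ho.mem_nhds (hKp hu))).continuousAt_iteratedFDeriv
        (by generalize k - i = n; exact_mod_cast le_top)).continuousWithinAt
  choose M hM using hb
  refine ⟨1 + ∑ i ∈ Finset.range (k + 1), (k.choose i : ℝ) * |M i|, by positivity,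
    fun x u hu δ hδ => ?_⟩
  have hut := hKp hu
  have hδ0 : 0 ≤ δ := (norm_nonneg _).trans (hδ 0 (by simp))
  have e1 : iteratedFDeriv ℝ k (chartOrbit p (infRep ρ X x)) u =
      iteratedFDerivWithin ℝ k (fun v => fderiv ℝ (chartOrbit p x) v (W v))
        (chartAt E p).target u := by
    rw [← iteratedFDerivWithin_of_isOpen k ho hut]
    exact iteratedFDerivWithin_congr (fun v hv => chartOrbit_infRep p X x hv) hut k
  have hF : ContDiffOn ℝ ∞ (fderiv ℝ (chartOrbit p x)) (chartAt E p).target :=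
    (contDiffOn_chartOrbit p x).fderiv_of_isOpen ho (by simp)
  rw [e1]
  refine (norm_iteratedFDerivWithin_clm_apply hF hW ho.uniqueDiffOn hut
    (n := k) (by exact_mod_cast le_top)).trans ?_
  rw [add_mul, Finset.sum_mul]
  refine (Finset.sum_le_sum fun i hi => ?_).trans (le_add_of_nonneg_left (by positivity))
  rw [iteratedFDerivWithin_of_isOpen _ ho hut, iteratedFDerivWithin_of_isOpen _ ho hut,
    norm_iteratedFDeriv_fderiv, mul_assoc, mul_assoc, mul_comm |M i|]
  gcongr
  · exact hδ i hi
  · exact (hM i u hu).trans (le_abs_self _)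

/-- The operator `ρ'(X)` on `H_∞`, which is continuous for the compact `C^∞`-topology. -/
def infRepL (ρ : G →* (H ≃ₗᵢ[ℂ] H)) (X : LieAlg E G) : SmoothVec E ρ →L[ℝ] SmoothVec E ρ where
  toFun := infRep ρ X
  map_add' := infRep_add_right X
  map_smul' := infRep_smul_right X
  cont := by
    refine continuous_iff_continuousAt.2 fun x => ?_
    refine tendsto_smoothVec_iff_sub.2 fun p k K hK hKp ε hε => ?_
    obtain ⟨C, hC, h⟩ := norm_iteratedFDeriv_chartOrbit_infRep_le (ρ := ρ) p X k hK hKp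
    have h1 : ∀ᶠ a in 𝓝 x, ∀ i ∈ Finset.range (k + 1), ∀ u ∈ K,
        ‖iteratedFDeriv ℝ (i + 1) (chartOrbit p (a - x)) u‖ < ε / (2 * C) :=
      (Filter.eventually_all_finset _).2 fun i _ =>
        tendsto_smoothVec_iff_sub.1 (continuous_id.tendsto x) p (i + 1) K hK hKp _ (by positivity)
    filter_upwards [h1] with a ha u hu
    have h2 : infRep ρ X a - infRep ρ X x = infRep ρ X (a - x) := by
      rw [sub_eq_iff_eq_add, ← infRep_add_right, sub_add_cancel]
    change ‖iteratedFDeriv ℝ k (chartOrbit p (infRep ρ X a - infRep ρ X x)) u‖ < ε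
    rw [h2]
    refine (h (a - x) u hu _ fun i hi => (ha i hi u hu).le).trans_lt ?_
    have : C * (ε / (2 * C)) = ε / 2 := by field_simp
    linarith

theorem infRep_lieBracket (X Y : LieAlg E G) (x : SmoothVec E ρ) :
    infRep ρ (lieBracket (G := G) X Y) x =
      infRep ρ Y (infRep ρ X x) - infRep ρ X (infRep ρ Y x) := by
  have h := mfderiv_mlieBracket (contMDiff_leftField X) (contMDiff_leftField (G := G) Y)
    (f := orbitMap x) (fV := orbitMap (infRep ρ X x)) (fW := orbitMap (infRep ρ Y x))
    (contMDiff_orbit x) (vecDeriv_orbitMap_leftField X x) (vecDeriv_orbitMap_leftField Y x)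
    (mdifferentiable_orbitMap _) (mdifferentiable_orbitMap _) 1
  refine SmoothVec.ext ?_
  rw [leftField_one, leftField_one] at h
  rw [SmoothVec.val_sub, infRep_val, lieBracket_eq_neg]
  refine (map_neg _ _).trans ?_
  rw [h, neg_sub]
  rfl

omit [CompleteSpace E] in
/-- `ρ'(X)ρ(g) = ρ(g)ρ'(Ad(g⁻¹)X)`. -/
theorem infRep_act (g : G) (X : LieAlg E G) (x : SmoothVec E ρ) :
    infRep ρ X (SmoothVec.act ρ g x) = SmoothVec.act ρ g (infRep ρ (Ad g⁻¹ X) x) := by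
  refine SmoothVec.ext ?_
  have hconj : MDifferentiableAt 𝓘(ℝ, E) 𝓘(ℝ, E) (fun h : G => g⁻¹ * h * g⁻¹⁻¹) 1 :=
    ((contMDiff_mul_right (n := ∞)).comp (contMDiff_mul_left (n := ∞))).mdifferentiableAt
      (by simp)
  have h1 := vecDeriv_comp (φ := orbitMap x) (g := (1 : G)) (g' := 1) (by simp)
    (mdifferentiable_orbitMap x 1) hconj
  have h2 : orbitMap (SmoothVec.act ρ g x) =
      realOp ρ g ∘ (orbitMap x ∘ fun h : G => g⁻¹ * h * g⁻¹⁻¹) := by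
    ext h
    change ρ h (ρ g x.val) = ρ g (ρ (g⁻¹ * h * g⁻¹⁻¹) x.val)
    simp [map_mul]
  rw [infRep_val, h2, vecDeriv_clm_comp, h1]
  · rfl
  · refine MDifferentiableAt.comp (I' := 𝓘(ℝ, E)) _ ?_ hconj
    exact mdifferentiable_orbitMap x _

/-- The derivative of `t ↦ ρ(γ(t))x` along a one-parameter subgroup `γ` with direction `X` is
`ρ(γ(t))ρ'(X)x`, so this curve is constant iff `ρ'(X)x = 0`. -/
theorem subgroupLieAlg_isotropyGroup [T2Space G] (x : SmoothVec E ρ) :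
    subgroupLieAlg E (isotropyGroup ρ x) = isotropyAlg ρ x := by
  ext X
  constructor
  · rintro ⟨γ, hγ, hX, hmem⟩
    have h0 : γ 0 = 1 := by simpa using hγ 0 0
    have h1 : orbitMap x ∘ γ = fun _ => x.val :=
      funext fun t => congrArg SmoothVec.val (hmem t)
    have h2 := (mdifferentiable_orbitMap x (γ 0)).hasMFDerivAt.comp (0 : ℝ) hX
    rw [h1] at h2
    have h3 : (vecDeriv E (orbitMap x) (γ 0)).comp (ContinuousLinearMap.toSpanSingleton ℝ X) = 0 :=
      hasMFDerivAt_unique h2 (hasMFDerivAt_const _ _)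
    have h4 := DFunLike.congr_fun h3 (1 : ℝ)
    refine SmoothVec.ext ?_
    rw [infRep_val, ← h0]
    simpa using h4
  · intro hX
    obtain ⟨γ, h0, hγ⟩ := exists_isMIntegralCurve_leftField (G := G) X
    refine ⟨γ, IsMIntegralCurve.map_add hγ h0, ?_, fun t => ?_⟩
    · refine (hγ 0).congr_mfderiv ?_
      refine ContinuousLinearMap.ext fun (r : ℝ) => ?_
      have h1 : (leftField X (γ 0) : E) = X := by rw [h0]; exact leftField_one X
      exact congrArg (fun Z : E => r • Z) h1
    · have h1 : ∀ t, HasDerivAt (orbitMap x ∘ γ) 0 t := fun t => by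
        have h2 : HasFDerivAt (orbitMap x ∘ γ) ((vecDeriv E (orbitMap x) (γ t)).comp
            ((1 : ℝ →L[ℝ] ℝ).smulRight (leftField X (γ t) : E))) t :=
          ((mdifferentiable_orbitMap x (γ t)).hasMFDerivAt.comp t (hγ t)).hasFDerivAt
        have h3 := h2.hasDerivAt
        have h4 : vecDeriv E (orbitMap x) (γ t) (leftField X (γ t)) = 0 := by
          rw [vecDeriv_orbitMap_leftField, show infRep ρ X x = 0 from hX]
          exact map_zero (ρ (γ t))
        convert! h3 using 1
        exact ((congrArg _ (one_smul ℝ (leftField X (γ t) : E))).trans h4).symm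
      have h3 := is_const_of_deriv_eq_zero (fun t => (h1 t).differentiableAt)
        (fun t => (h1 t).deriv) t 0
      have h4 : ρ (γ t) x.val = ρ (γ 0) x.val := h3
      refine SmoothVec.ext (h4.trans ?_)
      rw [h0, map_one]
      rfl

end Representation

/-! ### The symplectic form -/

section Symplectic

variable {E : Type*} [NormedAddCommGroup E] [NormedSpace ℝ E]
  {G : Type*} [TopologicalSpace G] [ChartedSpace E G] [Group G]
  {H : Type*} [NormedAddCommGroup H] [InnerProductSpace ℂ H]

/-- The symplectic form `ω` as a bilinear map. -/
def omegaBilin (ρ : G →* (H ≃ₗᵢ[ℂ] H)) : SmoothVec E ρ →ₗ[ℝ] SmoothVec E ρ →ₗ[ℝ] ℝ :=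
  LinearMap.mk₂ ℝ (omega ρ)
    (fun x x' y => by simp [omega])
    (fun c x y => by simp [omega, inner_smul_right_eq_smul])
    (fun x y y' => by simp [omega])
    (fun c x y => by simp [omega, inner_smul_left_eq_smul])

variable {ρ : G →* (H ≃ₗᵢ[ℂ] H)}

@[simp] theorem omegaBilin_apply (x y : SmoothVec E ρ) : omegaBilin ρ x y = omega ρ x y := rfl

theorem omega_neg_swap (x y : SmoothVec E ρ) : omega ρ x y = - omega ρ y x := by
  rw [omega, omega, ← inner_conj_symm, Complex.conj_im]

/-- `ω` is nondegenerate, since `ω(z, iz) = -‖z‖²`. -/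
theorem eq_zero_of_omega_eq_zero {z : SmoothVec E ρ} (h : ∀ y, omega ρ z y = 0) : z = 0 := by
  have h1 := h (Complex.I • z)
  rw [omega, SmoothVec.val_smul, inner_smul_left, inner_self_eq_norm_sq_to_K] at h1
  refine SmoothVec.ext (norm_eq_zero.1 ?_)
  simpa [← Complex.ofReal_pow] using h1

theorem eq_of_omega_eq {z z' : SmoothVec E ρ} (h : ∀ y, omega ρ z y = omega ρ z' y) : z = z' := by
  refine sub_eq_zero.1 (eq_zero_of_omega_eq_zero fun y => ?_)
  rw [← omegaBilin_apply, map_sub, LinearMap.sub_apply, omegaBilin_apply, omegaBilin_apply, h,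
    sub_self]

variable [LieGroup 𝓘(ℝ, E) ∞ G]

theorem contDiff_omega {x y : ℝ → SmoothVec E ρ} (hx : SmoothCurve x) (hy : SmoothCurve y) :
    ContDiff ℝ ∞ fun t => omega ρ (x t) (y t) := by
  have hx' : ContDiff ℝ ∞ (valL ρ ∘ x) := smoothCurve_iff_contDiff.1 (hx.clm_comp _)
  have hy' : ContDiff ℝ ∞ (valL ρ ∘ y) := smoothCurve_iff_contDiff.1 (hy.clm_comp _)
  exact Complex.imCLM.contDiff.comp (hy'.inner ℂ hx')

/-- The operators `ρ'(X)` are skew for `ω`, because `⟨ρ(g)x, ρ(g)y⟩` does not depend on `g`. -/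
theorem omega_infRep_left (X : LieAlg E G) (x y : SmoothVec E ρ) :
    omega ρ (infRep ρ X x) y = - omega ρ x (infRep ρ X y) := by
  set u := chartAt E (1 : G) 1
  have hu : u ∈ (chartAt E (1 : G)).target := mem_chart_target E 1
  have h1 : ∀ z : SmoothVec E ρ, chartOrbit 1 z u = z.val := fun z => by
    rw [chartOrbit, (chartAt E (1 : G)).left_inv (mem_chart_source E 1), map_one]
    rfl
  have h2 := fderiv_inner_apply ℂ ((contDiffAt_chartOrbit y hu).differentiableAt (by simp))
    ((contDiffAt_chartOrbit x hu).differentiableAt (by simp))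
    (chartField 1 (leftField (G := G) X) u)
  have h3 : (fun v => inner ℂ (chartOrbit (1 : G) y v) (chartOrbit 1 x v)) =
      fun _ => inner ℂ y.val x.val := funext fun v => (ρ _).inner_map_map _ _
  rw [h3, ← chartOrbit_infRep 1 X x hu, ← chartOrbit_infRep 1 X y hu, h1, h1, h1, h1] at h2
  have h4 := congrArg Complex.im h2
  simp only [fderiv_fun_const, Pi.zero_apply, zero_apply, Complex.zero_im, Complex.add_im] at h4
  rw [omega, omega]
  linarith

theorem omega_infRep_comm (X : LieAlg E G) (x y : SmoothVec E ρ) :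
    omega ρ (infRep ρ X x) y = omega ρ (infRep ρ X y) x := by
  rw [omega_infRep_left, omega_neg_swap, neg_neg]

end Symplectic

/-! ### The polarized moment map -/

section Moment

variable {E : Type*} [NormedAddCommGroup E] [NormedSpace ℝ E] [FiniteDimensional ℝ E]
  {G : Type*} [TopologicalSpace G] [ChartedSpace E G] [Group G] [LieGroup 𝓘(ℝ, E) ∞ G]
  {H : Type*} [NormedAddCommGroup H] [InnerProductSpace ℂ H]

/-- The polarized moment map `B(x, y)(X) = ω(ρ'(X)x, y)`, a symmetric bilinear map. It is also the
derivative of the moment map at `x` in the direction `y`. -/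
def polar (ρ : G →* (H ≃ₗᵢ[ℂ] H)) : SmoothVec E ρ →ₗ[ℝ] SmoothVec E ρ →ₗ[ℝ] LieDual E G :=
  LinearMap.mk₂ ℝ
    (fun x y => LinearMap.toContinuousLinearMap
      { toFun := fun X => omegaBilin ρ (infRep ρ X x) y
        map_add' := fun X Y => by
          have h := infRep_lin_left x 1 1 X Y
          rw [one_smul, one_smul, one_smul, one_smul] at h
          rw [h, map_add, LinearMap.add_apply]
        map_smul' := fun c X => by
          have h := infRep_lin_left x c 0 X X
          rw [zero_smul, zero_smul, add_zero, add_zero] at h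
          rw [h, map_smul, LinearMap.smul_apply, RingHom.id_apply] })
    (fun x x' y => by ext X; simp [-omegaBilin_apply, infRep_add_right])
    (fun c x y => by ext X; simp [-omegaBilin_apply, infRep_smul_right])
    (fun x y y' => by ext X; simp [-omegaBilin_apply])
    (fun c x y => by ext X; simp [-omegaBilin_apply])

variable {ρ : G →* (H ≃ₗᵢ[ℂ] H)}

theorem polar_apply (x y : SmoothVec E ρ) (X : LieAlg E G) :
    polar ρ x y X = omega ρ (infRep ρ X x) y := rfl

theorem polar_comm (x y : SmoothVec E ρ) : polar ρ x y = polar ρ y x := by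
  ext X
  exact omega_infRep_comm X x y

theorem moment_eq (x : SmoothVec E ρ) : moment ρ x = (1 / 2 : ℝ) • polar ρ x x := rfl

theorem hasLineDerivAt_moment (x y : SmoothVec E ρ) :
    HasLineDerivAt ℝ (moment ρ) (polar ρ x y) x y := by
  have h : (fun t : ℝ => moment ρ (x + t • y)) =
      fun t => moment ρ x + t • polar ρ x y + t ^ 2 • moment ρ y := by
    funext t
    simp only [moment_eq, map_add, map_smul, LinearMap.add_apply, LinearMap.smul_apply,
      polar_comm y x]
    module
  rw [HasLineDerivAt, h]
  have h1 := (((hasDerivAt_id (0 : ℝ)).smul_const (polar ρ x y)).const_add (moment ρ x)).add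
    (((hasDerivAt_id (0 : ℝ)).pow 2).smul_const (moment ρ y))
  convert! h1 using 1
  simp

theorem contDiff_polar {x y : ℝ → SmoothVec E ρ} (hx : SmoothCurve x) (hy : SmoothCurve y) :
    ContDiff ℝ ∞ fun t => polar ρ (x t) (y t) :=
  contDiff_clm_apply_iff.2 fun X => contDiff_omega (hx.clm_comp (infRepL ρ X)) hy

theorem contDiff_moment {x : ℝ → SmoothVec E ρ} (hx : SmoothCurve x) :
    ContDiff ℝ ∞ fun t => moment ρ (x t) :=
  (contDiff_polar hx hx).const_smul (1 / 2 : ℝ)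

theorem SmoothCurve.infRep {X : ℝ → LieAlg E G} (hX : ContDiff ℝ ∞ X) {x : ℝ → SmoothVec E ρ}
    (hx : SmoothCurve x) : SmoothCurve fun t => infRep ρ (X t) (x t) := by
  let b := Module.finBasis ℝ E
  have h1 : (fun t => UnitaryMoment.infRep ρ (X t) (x t)) =
      ∑ i, fun t => b.repr (X t) i • infRepL ρ (b i) (x t) := by
    funext t
    conv_lhs => rw [← b.sum_repr (X t)]
    refine SmoothVec.ext ?_
    have h2 : (valL ρ : SmoothVec E ρ →L[ℝ] H) (∑ i, b.repr (X t) i • infRepL ρ (b i) (x t)) =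
        ∑ i, b.repr (X t) i • vecDeriv E (orbitMap (x t)) 1 (b i) := by
      rw [map_sum]
      exact Finset.sum_congr rfl fun i _ => map_smul _ _ _
    rw [Finset.sum_apply, infRep_val, map_sum]
    simp only [map_smul]
    exact h2.symm
  rw [h1]
  refine SmoothCurve.sum _ fun i _ => SmoothCurve.smul ?_ (hx.clm_comp (infRepL ρ (b i)))
  exact (LinearMap.toContinuousLinearMap (b.coord i)).contDiff.comp hX

/-- The image of `dμ(x)` is the annihilator of the isotropy algebra: the common kernel of the
functionals `X ↦ ω(ρ'(X)x, y)` is `𝔤_x` by nondegeneracy, and `𝔤` is finite dimensional. -/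
theorem range_polar (x : SmoothVec E ρ) : Set.range (polar ρ x) =
    {α : LieDual E G | ∀ X ∈ isotropyAlg ρ x, α X = 0} := by
  apply Set.Subset.antisymm
  · rintro _ ⟨y, rfl⟩ X hX
    rw [polar_apply, show infRep ρ X x = 0 from hX, ← omegaBilin_apply, map_zero,
      LinearMap.zero_apply]
  · intro α hα
    let e : LieDual E G ≃ₗ[ℝ] Module.Dual ℝ E := LinearMap.toContinuousLinearMap.symm
    let Φ : Submodule ℝ (Module.Dual ℝ E) := LinearMap.range (e.toLinearMap ∘ₗ polar ρ x)
    have h1 : e α ∈ Φ.dualCoannihilator.dualAnnihilator := by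
      rw [Submodule.mem_dualAnnihilator]
      intro X hX
      refine hα X (eq_zero_of_omega_eq_zero fun y => ?_)
      exact (Submodule.mem_dualCoannihilator _).1 hX _ ⟨y, rfl⟩
    rw [Subspace.dualCoannihilator_dualAnnihilator_eq] at h1
    obtain ⟨y, hy⟩ := h1
    exact ⟨y, e.injective hy⟩

theorem ker_polar (x : SmoothVec E ρ) : {y | polar ρ x y = 0} =
    {y | ∀ z ∈ orbitTangent ρ x, omega ρ y z = 0} := by
  ext y
  simp only [Set.mem_ofPred_eq, orbitTangent, Set.forall_mem_range]
  rw [ContinuousLinearMap.ext_iff]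
  refine forall_congr' fun X => ?_
  rw [polar_apply, omega_neg_swap]
  exact neg_eq_zero

omit [FiniteDimensional ℝ E] in
theorem coAd_moment (g : G) (x : SmoothVec E ρ) :
    coAd g (moment ρ x) = moment ρ (SmoothVec.act ρ g x) := by
  ext X
  have h : ∀ a b : SmoothVec E ρ, omega ρ (SmoothVec.act ρ g a) (SmoothVec.act ρ g b) =
      omega ρ a b := fun a b => congrArg Complex.im ((ρ g).inner_map_map b.val a.val)
  change 1 / 2 * omega ρ (infRep ρ (Ad g⁻¹ X) x) x = 1 / 2 * omega ρ (infRep ρ X _) _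
  rw [infRep_act, h]

end Moment

/-! ### Functions of the moment map -/

section Pullback

/-- The identification of the bidual `𝔤''` with `𝔤`. -/
def bidualInv (E : Type*) [NormedAddCommGroup E] [NormedSpace ℝ E] [FiniteDimensional ℝ E]
    (G : Type*) [TopologicalSpace G] [ChartedSpace E G] [Group G] :
    (LieDual E G →L[ℝ] ℝ) →L[ℝ] LieAlg E G :=
  LinearMap.toContinuousLinearMap
    { toFun := fun L : LieDual E G →L[ℝ] ℝ => (exists_eval_eq (E := E) (G := G) L).choose
      map_add' := fun L L' => by
        have h (M : LieDual E G →L[ℝ] ℝ) := (exists_eval_eq (E := E) (G := G) M).choose_spec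
        refine (SeparatingDual.eq_iff_forall_dual_eq (R := ℝ) (V := E)).2 fun β => ?_
        rw [map_add β, ← h (L + L') β, ← h L β, ← h L' β, add_apply]
      map_smul' := fun c L => by
        have h (M : LieDual E G →L[ℝ] ℝ) := (exists_eval_eq (E := E) (G := G) M).choose_spec
        refine (SeparatingDual.eq_iff_forall_dual_eq (R := ℝ) (V := E)).2 fun β => ?_
        rw [map_smul β, ← h (c • L) β, ← h L β, smul_apply, RingHom.id_apply] }

variable {E : Type*} [NormedAddCommGroup E] [NormedSpace ℝ E] [FiniteDimensional ℝ E]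
  {G : Type*} [TopologicalSpace G] [ChartedSpace E G] [Group G]

theorem apply_bidualInv (L : LieDual E G →L[ℝ] ℝ) (β : LieDual E G) :
    β (bidualInv E G L) = L β :=
  ((exists_eval_eq (G := G) L).choose_spec β).symm

theorem dualDiff_eq (f : LieDual E G → ℝ) (α : LieDual E G) :
    dualDiff f α = bidualInv E G (fderiv ℝ f α) := rfl

theorem contDiff_dualDiff {f : LieDual E G → ℝ} (hf : ContDiff ℝ ∞ f) :
    ContDiff ℝ ∞ (dualDiff (G := G) f) :=
  (bidualInv E G).contDiff.comp (hf.fderiv_right (by simp))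

variable [LieGroup 𝓘(ℝ, E) ∞ G]

theorem contDiff_dualPoisson {f₁ f₂ : LieDual E G → ℝ} (h₁ : ContDiff ℝ ∞ f₁)
    (h₂ : ContDiff ℝ ∞ f₂) : ContDiff ℝ ∞ (dualPoisson (G := G) f₁ f₂) := by
  have h := (((lieBracketBilin E G).toContinuousBilinearMap.contDiff (n := ∞)).comp
    (contDiff_dualDiff h₁)).clm_apply (contDiff_dualDiff h₂)
  exact contDiff_id.clm_apply h

variable {H : Type*} [NormedAddCommGroup H] [InnerProductSpace ℂ H] {ρ : G →* (H ≃ₗᵢ[ℂ] H)}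

/-- The space of values of the basic invariants of a point of `H_∞` and `k` tangent vectors. -/
abbrev InvariantSpace (E : Type*) [NormedAddCommGroup E] [NormedSpace ℝ E]
    (G : Type*) [TopologicalSpace G] [ChartedSpace E G] [Group G] (k : ℕ) : Type _ :=
  LieDual E G × (Fin k → LieDual E G) × (Fin k → Fin k → LieDual E G)

/-- The basic invariants of `x` and `y₁, …, y_k`: the moment `μ(x)` and the polarized moments
`B(x, y_a)` and `B(y_a, y_b)`. The iterated derivatives of `f ∘ μ` are functions of these. -/
def invariants (k : ℕ) (x : SmoothVec E ρ) (y : Fin k → SmoothVec E ρ) : InvariantSpace E G k :=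
  (moment ρ x, fun a => polar ρ x (y a), fun a b => polar ρ (y a) (y b))

/-- The chain rule for functions of the basic invariants; the `B(y_a, y_b)` do not depend on `x`. -/
theorem hasLineDerivAt_invariants {k : ℕ} {φ : InvariantSpace E G k → ℝ} (hφ : ContDiff ℝ ∞ φ)
    (x v : SmoothVec E ρ) (y : Fin k → SmoothVec E ρ) :
    HasLineDerivAt ℝ (fun x => φ (invariants k x y))
      (fderiv ℝ φ (invariants k x y) (polar ρ x v, fun a => polar ρ (y a) v, 0)) x v := by
  have h1 : HasDerivAt (fun t : ℝ => invariants k (x + t • v) y)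
      (polar ρ x v, fun a => polar ρ (y a) v, 0) 0 := by
    refine HasDerivAt.prodMk (hasLineDerivAt_moment x v)
      (HasDerivAt.prodMk (hasDerivAt_pi.2 fun a => ?_) (hasDerivAt_const _ _))
    have h2 : (fun t : ℝ => polar ρ (x + t • v) (y a)) =
        fun t => polar ρ x (y a) + t • polar ρ (y a) v := by
      funext t
      rw [map_add, map_smul, LinearMap.add_apply, LinearMap.smul_apply, polar_comm v]
    rw [h2]
    simpa using ((hasDerivAt_id (0 : ℝ)).smul_const (polar ρ (y a) v)).const_add
      (polar ρ x (y a))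
  have h3 : HasFDerivAt φ (fderiv ℝ φ (invariants k x y)) (invariants k (x + (0 : ℝ) • v) y) := by
    rw [zero_smul, add_zero]
    exact (hφ.differentiable (by simp) _).hasFDerivAt
  exact h3.comp_hasDerivAt (0 : ℝ) h1

theorem exists_iterDeriv_eq {f : LieDual E G → ℝ} (hf : ContDiff ℝ ∞ f) (k : ℕ) :
    ∃ φ : InvariantSpace E G k → ℝ, ContDiff ℝ ∞ φ ∧
      ∀ (y : Fin k → SmoothVec E ρ) x, iterDeriv (f ∘ moment ρ) k y x = φ (invariants k x y) := by
  induction k with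
  | zero => exact ⟨fun p => f p.1, hf.comp contDiff_fst, fun y x => rfl⟩
  | succ k ih =>
    obtain ⟨φ, hφ, h⟩ := ih
    refine ⟨fun p => fderiv ℝ φ (p.1, fun a => p.2.1 a.succ, fun a b => p.2.2 a.succ b.succ)
      (p.2.1 0, fun a => p.2.2 a.succ 0, 0), ?_, fun y x => ?_⟩
    · refine ContDiff.clm_apply ((hφ.fderiv_right (m := ∞) (by simp)).comp ?_) ?_ <;> fun_prop
    · have h1 : iterDeriv (f ∘ moment ρ) k (Fin.tail y) =
          fun x => φ (invariants k x (Fin.tail y)) := funext (h _)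
      rw [iterDeriv, h1]
      exact (hasLineDerivAt_invariants hφ x (y 0) (Fin.tail y)).lineDeriv

/-- The partial derivatives of a function of the basic invariants, in the directions of `μ(x)` (for
`none`) and of `B(x, y_a)` (for `some a`), as elements of `𝔤`. -/
def partialDiff {k : ℕ} (φ : InvariantSpace E G k → ℝ) (p : InvariantSpace E G k) :
    Option (Fin k) → LieAlg E G
  | none => bidualInv E G ((fderiv ℝ φ p).comp (ContinuousLinearMap.inl ℝ _ _))
  | some a => bidualInv E G ((fderiv ℝ φ p).comp ((ContinuousLinearMap.inr ℝ _ _).comp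
      ((ContinuousLinearMap.inl ℝ _ _).comp
        (ContinuousLinearMap.single ℝ (fun _ => LieDual E G) a))))

/-- The gradient with respect to `x` of a function of the basic invariants. -/
def invariantGrad {k : ℕ} (φ : InvariantSpace E G k → ℝ)
    (z : SmoothVec E ρ × (Fin k → SmoothVec E ρ)) : SmoothVec E ρ :=
  infRep ρ (partialDiff φ (invariants k z.1 z.2) none) z.1 +
    ∑ a, infRep ρ (partialDiff φ (invariants k z.1 z.2) (some a)) (z.2 a)

theorem fderiv_eq_omega_invariantGrad {k : ℕ} (φ : InvariantSpace E G k → ℝ)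
    (x v : SmoothVec E ρ) (y : Fin k → SmoothVec E ρ) :
    fderiv ℝ φ (invariants k x y) (polar ρ x v, fun a => polar ρ (y a) v, 0) =
      omega ρ (invariantGrad φ (x, y)) v := by
  set L := fderiv ℝ φ (invariants k x y) with hL
  have h1 : ((polar ρ x v, fun a => polar ρ (y a) v, 0) : InvariantSpace E G k) =
      (polar ρ x v, 0) + ∑ a, (0, Pi.single a (polar ρ (y a) v), 0) := by
    have h2 : (fun a => polar ρ (y a) v) = ∑ a, Pi.single a (polar ρ (y a) v) :=
      (Finset.univ_sum_single _).symm
    refine Prod.ext ?_ (Prod.ext ?_ ?_)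
    · simp [Prod.fst_sum]
    · simpa [Prod.fst_sum, Prod.snd_sum] using h2
    · simp [Prod.snd_sum]
  rw [h1, map_add, map_sum, ← omegaBilin_apply, invariantGrad, map_add, map_sum,
    LinearMap.add_apply, LinearMap.sum_apply]
  refine congrArg₂ (· + ·) ?_ (Finset.sum_congr rfl fun a _ => ?_)
  · rw [omegaBilin_apply, ← polar_apply, partialDiff, apply_bidualInv]
    rfl
  · rw [omegaBilin_apply, ← polar_apply, partialDiff, apply_bidualInv]
    rfl

theorem contDiff_invariants {k : ℕ} {x : ℝ → SmoothVec E ρ} {y : ℝ → Fin k → SmoothVec E ρ}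
    (hx : SmoothCurve x) (hy : ∀ a, SmoothCurve fun t => y t a) :
    ContDiff ℝ ∞ fun t => invariants k (x t) (y t) :=
  (contDiff_moment hx).prodMk ((contDiff_pi.2 fun a => contDiff_polar hx (hy a)).prodMk
    (contDiff_pi.2 fun a => contDiff_pi.2 fun b => contDiff_polar (hy a) (hy b)))

omit [LieGroup 𝓘(ℝ, E) ∞ G] in
theorem contDiff_partialDiff {k : ℕ} {φ : InvariantSpace E G k → ℝ} (hφ : ContDiff ℝ ∞ φ)
    (a : Option (Fin k)) : ContDiff ℝ ∞ fun p => partialDiff φ p a := by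
  have h := hφ.fderiv_right (m := ∞) (by simp)
  cases a with
  | none => exact (bidualInv E G).contDiff.comp (h.clm_comp
      (contDiff_const (c := ContinuousLinearMap.inl ℝ _ _)))
  | some a => exact (bidualInv E G).contDiff.comp (h.clm_comp
      (contDiff_const (c := (ContinuousLinearMap.inr ℝ _ _).comp
        ((ContinuousLinearMap.inl ℝ _ _).comp
          (ContinuousLinearMap.single ℝ (fun _ => LieDual E G) a)))))

theorem fkSmooth_invariantGrad {k : ℕ} {φ : InvariantSpace E G k → ℝ} (hφ : ContDiff ℝ ∞ φ) :
    FKSmooth (invariantGrad (ρ := ρ) φ) := fun c hc => by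
  have hx : SmoothCurve fun t => (c t).1 :=
    hc.clm_comp (ContinuousLinearMap.fst ℝ (SmoothVec E ρ) (Fin k → SmoothVec E ρ))
  have hy : ∀ a, SmoothCurve fun t => (c t).2 a := fun a =>
    hc.clm_comp ((ContinuousLinearMap.proj (φ := fun _ => SmoothVec E ρ) a).comp
      (ContinuousLinearMap.snd ℝ (SmoothVec E ρ) (Fin k → SmoothVec E ρ)))
  have hp : ∀ a, ContDiff ℝ ∞ fun t => partialDiff φ (invariants k (c t).1 (c t).2) a := fun a =>
    (contDiff_partialDiff hφ a).comp (contDiff_invariants hx hy)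
  have h := (hx.infRep (hp none)).add
    (SmoothCurve.sum Finset.univ fun a _ => (hy a).infRep (hp (some a)))
  convert! h using 1
  funext t
  simp [invariantGrad]

theorem memCStar_comp_moment {f : LieDual E G → ℝ} (hf : ContDiff ℝ ∞ f) :
    MemCStar ρ (f ∘ moment (E := E) ρ) := by
  refine ⟨fun c hc => smoothCurve_iff_contDiff.2 (hf.comp (contDiff_moment hc)), fun k => ?_⟩
  obtain ⟨φ, hφ, h⟩ := exists_iterDeriv_eq (ρ := ρ) hf k
  refine ⟨invariantGrad φ, fkSmooth_invariantGrad hφ, fun x y v => ?_⟩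
  have h1 : iterDeriv (f ∘ moment ρ) k y = fun x => φ (invariants k x y) := funext (h _)
  rw [iterDeriv, Fin.tail_cons, Fin.cons_zero, h1, ← fderiv_eq_omega_invariantGrad]
  exact (hasLineDerivAt_invariants hφ x v y).lineDeriv

theorem memCStarDual_moment : MemCStarDual ρ (moment (E := E) ρ) :=
  ⟨fun _ hc => smoothCurve_iff_contDiff.2 (contDiff_moment hc), fun X =>
    memCStar_comp_moment (f := fun α : LieDual E G => α X)
      (ContinuousLinearMap.apply ℝ ℝ (X : E)).contDiff⟩

theorem omegaGrad_comp_moment {f : LieDual E G → ℝ} (hf : ContDiff ℝ ∞ f) (x : SmoothVec E ρ) :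
    omegaGrad ρ (f ∘ moment ρ) x = infRep ρ (dualDiff f (moment ρ x)) x := by
  have h : ∀ y, lineDeriv ℝ (f ∘ moment ρ) x y =
      omega ρ (infRep ρ (dualDiff f (moment ρ x)) x) y := fun y => by
    have h1 : HasDerivAt (fun t : ℝ => moment ρ (x + t • y)) (polar ρ x y) 0 :=
      hasLineDerivAt_moment x y
    have h2 : HasFDerivAt f (fderiv ℝ f (moment ρ x)) (moment ρ (x + (0 : ℝ) • y)) := by
      rw [zero_smul, add_zero]
      exact (hf.differentiable (by simp) _).hasFDerivAt
    have h3 : HasLineDerivAt ℝ (f ∘ moment ρ) (fderiv ℝ f (moment ρ x) (polar ρ x y)) x y :=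
      h2.comp_hasDerivAt (0 : ℝ) h1
    rw [h3.lineDeriv, ← polar_apply, dualDiff_eq, apply_bidualInv]
  have h4 := Classical.epsilon_spec
    (p := fun z => ∀ y, lineDeriv ℝ (f ∘ moment ρ) x y = omega ρ z y) ⟨_, h⟩
  exact eq_of_omega_eq fun y => (h4 y).symm.trans (h y)

theorem dualPoisson_comp_moment {f₁ f₂ : LieDual E G → ℝ} (h₁ : ContDiff ℝ ∞ f₁)
    (h₂ : ContDiff ℝ ∞ f₂) : dualPoisson (G := G) f₁ f₂ ∘ moment (E := E) ρ =
      poisson ρ (f₁ ∘ moment (E := E) ρ) (f₂ ∘ moment (E := E) ρ) := by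
  funext x
  rw [poisson, omegaGrad_comp_moment h₁, omegaGrad_comp_moment h₂, Function.comp_apply,
    dualPoisson]
  set X := dualDiff f₁ (moment ρ x)
  set Y := dualDiff f₂ (moment ρ x)
  change 1 / 2 * omega ρ (infRep ρ (lieBracket (G := G) X Y) x) x = _
  rw [infRep_lieBracket, ← omegaBilin_apply, map_sub, LinearMap.sub_apply, omegaBilin_apply,
    omegaBilin_apply, omega_infRep_comm Y, omega_infRep_comm X,
    omega_neg_swap (infRep ρ X x)]
  ring

end Pullback

end UnitaryMoment

end

theorem theorem8p4
    {E : Type*} [NormedAddCommGroup E] [NormedSpace ℝ E] [FiniteDimensional ℝ E]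
    {G : Type*} [TopologicalSpace G] [T2Space G] [SecondCountableTopology G] [ChartedSpace E G]
    [Group G] [LieGroup 𝓘(ℝ, E) ∞ G]
    {H : Type*} [NormedAddCommGroup H] [InnerProductSpace ℂ H] [CompleteSpace H]
    (ρ : G →* (H ≃ₗᵢ[ℂ] H)) (hρ : ∀ x : H, Continuous fun g : G => ρ g x) :
    -- the derivative of `μ`, and `μ ∈ C^∞_*(H_∞, 𝔤')`
    ((∀ x y : SmoothVec E ρ, LineDifferentiableAt ℝ (moment ρ) x y ∧
        ∀ X : LieAlg E G, lineDeriv ℝ (moment ρ) x y X = omega ρ (infRep ρ X x) y) ∧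
      MemCStarDual ρ (moment (E := E) ρ)) ∧
    -- `𝔤_x` is the Lie algebra of `G_x`, and its annihilator is the image of `dμ(x)`
    (∀ x : SmoothVec E ρ,
      subgroupLieAlg E (isotropyGroup ρ x) = isotropyAlg ρ x ∧
      Set.range (fun y : SmoothVec E ρ => lineDeriv ℝ (moment ρ) x y) =
        {α : LieDual E G | ∀ X ∈ isotropyAlg ρ x, α X = 0}) ∧
    -- the kernel of `dμ(x)` is the `ω`-annihilator of the tangent space of the orbit
    (∀ x : SmoothVec E ρ,
      {y : SmoothVec E ρ | lineDeriv ℝ (moment ρ) x y = 0} =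
        {y : SmoothVec E ρ | ∀ z ∈ orbitTangent ρ x, omega ρ y z = 0}) ∧
    -- equivariance
    (∀ (g : G) (x : SmoothVec E ρ),
      coAd g (moment ρ x) = moment ρ (SmoothVec.act ρ g x)) ∧
    -- the pullback maps `C^∞(𝔤', ℝ)` into `C^∞_*(H_∞, ℝ)` and is a Lie algebra homomorphism
    (∀ f : LieDual E G → ℝ, ContDiff ℝ ∞ f → MemCStar ρ (f ∘ moment (E := E) ρ)) ∧
    (∀ (a b : ℝ) (f₁ f₂ : LieDual E G → ℝ),
      (a • f₁ + b • f₂) ∘ moment (E := E) ρ =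
        a • (f₁ ∘ moment (E := E) ρ) + b • (f₂ ∘ moment (E := E) ρ)) ∧
    (∀ f₁ f₂ : LieDual E G → ℝ, ContDiff ℝ ∞ f₁ → ContDiff ℝ ∞ f₂ →
      ContDiff ℝ ∞ (dualPoisson (G := G) f₁ f₂) ∧
      dualPoisson (G := G) f₁ f₂ ∘ moment (E := E) ρ =
        poisson ρ (f₁ ∘ moment (E := E) ρ) (f₂ ∘ moment (E := E) ρ)) := by
  have hd : ∀ x y : SmoothVec E ρ, lineDeriv ℝ (moment ρ) x y = polar ρ x y := fun x y =>
    (hasLineDerivAt_moment x y).lineDeriv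
  refine ⟨⟨fun x y => ⟨(hasLineDerivAt_moment x y).lineDifferentiableAt, fun X => ?_⟩,
    memCStarDual_moment⟩, fun x => ⟨subgroupLieAlg_isotropyGroup x, ?_⟩, fun x => ?_, coAd_moment,
    fun f hf => memCStar_comp_moment hf, fun a b f₁ f₂ => rfl,
    fun f₁ f₂ h₁ h₂ => ⟨contDiff_dualPoisson h₁ h₂, dualPoisson_comp_moment h₁ h₂⟩⟩
  · rw [hd, polar_apply]
  · simp only [hd]
    exact range_polar x
  · simp only [hd]
    exact ker_polar x
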